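/- \textbf{Theorem (Specker), in ZF without the axiom of choice.} For sets $a,b$ write $a\preceq b$ if there is an injection $a\to b$, $a\approx b$ if there is a bijection $a\to b$, and $a\prec b$ if $a\preceq b$ and $a\not\approx b$. Let $\mathcal{P}x$ be the power set of $x$. A set $x$ is a \emph{GCH-set} if $x$ is finite or there is no set $y$ with $x\prec y\prec\mathcal{P}x$. The \emph{Hartogs number} $\aleph(x)$ is the least ordinal that does not inject into $x$, and a set is \emph{well-orderable} if it is equinumerous with an ordinal. The following is a theorem of ZF, that is, it holds for every element $x$ of every model of ZF, with all notions interpreted in that model: if $\omega\preceq x$ and both $x$ and $\mathcal{P}x$ are GCH-sets, then $\aleph(x)$ exists and $\aleph(x)\approx\mathcal{P}x$; in particular $\mathcal{P}x$ and $x$ are well-orderable. -/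

import Mathlib

namespace ZFModel

universe u

/-- The only symbol of the language of set theory: the binary relation symbol for membership. -/
inductive MemRel : ℕ → Type
  | mem : MemRel 2

/-- The first-order language of set theory. -/
def setLang : FirstOrder.Language.{0, 0} := ⟨fun _ => Empty, MemRel⟩

variable {M : Type u} [setLang.Structure M]

/-- Membership in a structure for the language of set theory. -/
def Mem (a b : M) : Prop :=
  FirstOrder.Language.Structure.RelMap (L := setLang) (M := M) MemRel.mem ![a, b]

infix:50 " ∈ᴹ " => Mem

/-- `a ⊆ b`. -/
def IsSubset (a b : M) : Prop := ∀ z, z ∈ᴹ a → z ∈ᴹ b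

/-- `e = ∅`. -/
def IsEmptySet (e : M) : Prop := ∀ z, ¬ z ∈ᴹ e

/-- `s = n ∪ {n}`. -/
def IsSucc (s n : M) : Prop := ∀ z, z ∈ᴹ s ↔ z ∈ᴹ n ∨ z = n

/-- `i` contains `∅` and is closed under `n ↦ n ∪ {n}`. -/
def IsInductive (i : M) : Prop :=
  (∃ e, IsEmptySet e ∧ e ∈ᴹ i) ∧ ∀ n, n ∈ᴹ i → ∃ s, IsSucc s n ∧ s ∈ᴹ i

/-- `c = {a, b}`. -/
def IsUPair (c a b : M) : Prop := ∀ z, z ∈ᴹ c ↔ z = a ∨ z = b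

variable (M) in
/-- `M` is a model of Zermelo–Fraenkel set theory ZF, without the axiom of choice. Nothing is
assumed beyond the first-order theory: `M` may be ill-founded or have nonstandard natural numbers.
In the two schemas, the class (the class relation) ranges over those that are defined in `M` by
a first-order formula of the language of set theory with parameters from `M`. -/
class ModelsZF : Prop where
  extensionality : ∀ a b : M, (∀ z, z ∈ᴹ a ↔ z ∈ᴹ b) → a = b
  foundation : ∀ a : M, (∃ y, y ∈ᴹ a) → ∃ y, y ∈ᴹ a ∧ ∀ z, z ∈ᴹ a → ¬ z ∈ᴹ y
  pairing : ∀ a b : M, ∃ c, IsUPair c a b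
  union : ∀ a : M, ∃ u, ∀ z, z ∈ᴹ u ↔ ∃ y, y ∈ᴹ a ∧ z ∈ᴹ y
  powerset : ∀ a : M, ∃ p, ∀ z, z ∈ᴹ p ↔ IsSubset z a
  infinity : ∃ i : M, IsInductive i
  separation : ∀ P : Set M, Set.Definable₁ Set.univ setLang P →
    ∀ a : M, ∃ b, ∀ z, z ∈ᴹ b ↔ z ∈ᴹ a ∧ z ∈ P
  replacement : ∀ R : Set (M × M), Set.Definable₂ Set.univ setLang R →
    ∀ a : M, (∀ y, y ∈ᴹ a → ∃! z, (y, z) ∈ R) → ∃ b, ∀ z, z ∈ᴹ b ↔ ∃ y, y ∈ᴹ a ∧ (y, z) ∈ R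

/-- The power set `𝒫 x`, formed in `M`. -/
noncomputable def pow [ModelsZF M] (x : M) : M := (ModelsZF.powerset x).choose

theorem mem_pow [ModelsZF M] (x z : M) : z ∈ᴹ pow x ↔ IsSubset z x :=
  (ModelsZF.powerset x).choose_spec z

/-- `p` is the Kuratowski ordered pair `(a, b) = {{a}, {a, b}}`. -/
def IsOPair (p a b : M) : Prop := ∀ z, z ∈ᴹ p ↔ IsUPair z a a ∨ IsUPair z a b

/-- `(a, b) ∈ f`. -/
def Rel (f a b : M) : Prop := ∃ p, IsOPair p a b ∧ p ∈ᴹ f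

/-- `f : a → b` is a function, as a set of ordered pairs in `M`. -/
def IsFunction (f a b : M) : Prop :=
  (∀ p, p ∈ᴹ f → ∃ y z, y ∈ᴹ a ∧ z ∈ᴹ b ∧ IsOPair p y z) ∧ ∀ y, y ∈ᴹ a → ∃! z, Rel f y z

/-- `f : a → b` is an injection in `M`. -/
def IsInjection (f a b : M) : Prop :=
  IsFunction f a b ∧ ∀ y y' z, Rel f y z → Rel f y' z → y = y'

/-- `f : a → b` is a bijection in `M`. -/
def IsBijection (f a b : M) : Prop :=
  IsInjection f a b ∧ ∀ z, z ∈ᴹ b → ∃ y, Rel f y z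

/-- `a ≼ b`. -/
def Dominated (a b : M) : Prop := ∃ f, IsInjection f a b

/-- `a ≈ b`. -/
def Equinumerous (a b : M) : Prop := ∃ f, IsBijection f a b

/-- `a ≺ b`. -/
def StrictlyDominated (a b : M) : Prop := Dominated a b ∧ ¬ Equinumerous a b

/-- `w = ω`, the least inductive set, whose elements are the natural numbers of `M`. -/
def IsOmega (w : M) : Prop := ∀ n, n ∈ᴹ w ↔ ∀ i, IsInductive i → n ∈ᴹ i

/-- `ω ≼ x`. -/
def OmegaDominated (x : M) : Prop := ∃ w, IsOmega w ∧ Dominated w x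

/-- `x` is finite: it is equinumerous with a natural number of `M`. -/
def IsFiniteSet (x : M) : Prop := ∃ w n, IsOmega w ∧ n ∈ᴹ w ∧ Equinumerous x n

/-- `x` is a GCH-set: it is finite, or no `y` satisfies `x ≺ y ≺ 𝒫 x`. -/
def IsGCHSet [ModelsZF M] (x : M) : Prop :=
  IsFiniteSet x ∨ ∀ y, ¬ (StrictlyDominated x y ∧ StrictlyDominated y (pow x))

/-- `a` is an ordinal: a transitive set which is well-ordered by membership. -/
def IsOrdinal (a : M) : Prop :=
  (∀ y, y ∈ᴹ a → IsSubset y a) ∧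
  (∀ y z, y ∈ᴹ a → z ∈ᴹ a → y ∈ᴹ z ∨ y = z ∨ z ∈ᴹ y) ∧
  ∀ s, IsSubset s a → (∃ y, y ∈ᴹ s) → ∃ y, y ∈ᴹ s ∧ ∀ z, z ∈ᴹ s → ¬ z ∈ᴹ y

/-- `h = ℵ(x)`, the Hartogs number of `x`: the least ordinal which does not inject into `x`. -/
def IsHartogs (h x : M) : Prop :=
  IsOrdinal h ∧ ¬ Dominated h x ∧ ∀ b, IsOrdinal b → ¬ Dominated b x → IsSubset h b

/-- `x` is well-orderable: it is equinumerous with an ordinal. -/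
def IsWellOrderable (x : M) : Prop := ∃ a, IsOrdinal a ∧ Equinumerous x a

end ZFModel

/-! Write + and × for `sum` and `prod`. For an infinite GCH-set x, `IsGCHSet.dominated_or` says that
x ≼ y ≼ 𝒫x forces y ≼ x or 𝒫x ≼ y. The proof feeds suitable y to this dichotomy and excludes or
exploits the upper alternative.

Arithmetic of x: x + x and then x × x lie between x and 𝒫x. The upper alternative would inject 𝒫x
into x × x, which `not_pow_dominated_prod` forbids when ω ≼ x: such an injection would let one list
distinct elements of x along all the ordinals. Hence x + x ≼ x and x × x ≼ x, and so 𝒫x × 𝒫x ≼ 𝒫(x +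
x) ≼ 𝒫x.

Comparison with h = ℵ(x): order codes give h ≼ 𝒫𝒫(x × x) ≼ 𝒫𝒫x, so 𝒫x + h lies between 𝒫x and 𝒫𝒫x.
Either h ≼ 𝒫x at once, or 𝒫𝒫x ≼ 𝒫x + h. In the second case `pow_dominated_of_sum` removes the
summand 𝒫x, so 𝒫x is well-orderable, and h ≼ 𝒫x by minimality of h. Now x + h lies between x and 𝒫x.
It cannot inject into x, so 𝒫x ≼ x + h, and removing x leaves 𝒫x ≼ h. Cantor–Bernstein concludes.

Since M is an arbitrary model, every set and every recursion must come from formulas with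
parameters. The classes `DefPred` and `DefFun` let instance search supply this definability. -/

set_option synthInstance.maxHeartbeats 400000
set_option synthInstance.maxSize 4000

/-! ### Definability with parameters, derived by instance search -/

namespace ZFModel

universe u

/-- A type of assignments of elements of `M` to finitely many variables. -/
class Context (M : outParam (Type u)) (X : Type u) where
  idx : Type
  finite_idx : Finite idx
  coords : X ≃ (idx → M)

instance (M X : Type u) [Context M X] : Finite (Context.idx X) := Context.finite_idx

instance (M : Type u) : Context M M where
  idx := Unit
  finite_idx := inferInstance
  coords := (Equiv.funUnique Unit M).symm

instance (M X : Type u) [Context M X] : Context M (X × M) where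
  idx := Option (Context.idx X)
  finite_idx := inferInstance
  coords :=
    { toFun := fun p i => i.elim p.2 (Context.coords p.1)
      invFun := fun v => (Context.coords.symm fun i => v (some i), v none)
      left_inv := fun p => by simp
      right_inv := fun v => by
        funext i
        cases i <;> simp }

section

variable {M : Type u} [setLang.Structure M] {X Y Z : Type u}
  [Context M X] [Context M Y] [Context M Z]

/-- The predicate `P` is definable in `M` with parameters. -/
class DefPred (P : X → Prop) : Prop where
  out : Set.univ.Definable setLang {v : Context.idx X → M | P (Context.coords.symm v)}

/-- The function `f` is definable in `M` with parameters. -/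
class DefFun (f : X → Y) : Prop where
  out : Set.univ.DefinableMap setLang
    fun v : Context.idx X → M => Context.coords (f (Context.coords.symm v))

theorem DefPred.subst {Q : Y → Prop} (hQ : DefPred Q) {f : X → Y} (hf : DefFun f) :
    DefPred fun x => Q (f x) := by
  constructor
  simpa [Set.preimage] using hQ.out.preimage_map hf.out

instance DefFun.id : DefFun fun x : X => x := by
  constructor
  intro i
  simpa using Set.DefinableFun.proj setLang

instance DefFun.const (c : M) : DefFun fun _ : X => c := by
  constructor
  intro i
  exact setLang.definableFun_const _ (Set.mem_univ _)

instance DefFun.fst (f : X → Y × M) [hf : DefFun f] : DefFun fun x => (f x).1 := by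
  constructor
  intro i
  exact hf.out (some i)

instance DefFun.snd (f : X → Y × M) [hf : DefFun f] : DefFun fun x => (f x).2 := by
  constructor
  intro i
  exact hf.out none

instance (priority := 10) DefFun.pair (f : X → Y) (g : X → M) [hf : DefFun f] [hg : DefFun g] :
    DefFun fun x => (f x, g x) := by
  constructor
  intro i
  cases i with
  | none => exact hg.out ()
  | some i => exact hf.out i

theorem DefFun.subst {g : Y → Z} (hg : DefFun g) {f : X → Y} (hf : DefFun f) :
    DefFun fun x => g (f x) := by
  constructor
  intro i
  have := Set.DefinableFun.comp hf.out (hg.out i)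
  simpa using this

/-- Any proposition independent of the point qualifies, first-order or not: it cuts out everything
or nothing. -/
instance (priority := 2000) DefPred.const (p : Prop) : DefPred fun _ : X => p := by
  constructor
  by_cases h : p
  · simp [h]
  · simp [h]

instance DefPred.and (P Q : X → Prop) [hP : DefPred P] [hQ : DefPred Q] :
    DefPred fun x => P x ∧ Q x :=
  ⟨hP.out.inter hQ.out⟩

instance DefPred.or (P Q : X → Prop) [hP : DefPred P] [hQ : DefPred Q] :
    DefPred fun x => P x ∨ Q x :=
  ⟨hP.out.union hQ.out⟩

instance DefPred.not (P : X → Prop) [hP : DefPred P] : DefPred fun x => ¬ P x :=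
  ⟨hP.out.compl⟩

instance (priority := 500) DefPred.imp (P Q : X → Prop) [hP : DefPred P] [hQ : DefPred Q] :
    DefPred fun x => P x → Q x := by
  simp only [imp_iff_not_or]
  infer_instance

instance DefPred.iff (P Q : X → Prop) [hP : DefPred P] [hQ : DefPred Q] :
    DefPred fun x => P x ↔ Q x := by
  simp only [iff_iff_implies_and_implies]
  infer_instance

/-- Existential quantification is the projection that forgets the coordinate `none`. -/
instance DefPred.ex (P : X → M → Prop) [hP : DefPred fun p : X × M => P p.1 p.2] :
    DefPred fun x => ∃ z, P x z := by
  constructor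
  convert hP.out.image_comp (fun i : Context.idx X => (some i : Context.idx (X × M))) using 1
  ext v
  constructor
  · rintro ⟨z, hz⟩
    refine ⟨Context.coords (X := X × M) (Context.coords.symm v, z), ?_, ?_⟩
    · simpa using hz
    · funext i
      simp [Context.coords]
  · rintro ⟨w, hw, rfl⟩
    exact ⟨_, hw⟩

instance DefPred.all (P : X → M → Prop) [hP : DefPred fun p : X × M => P p.1 p.2] :
    DefPred fun x => ∀ z, P x z := by
  have : DefPred fun x => ¬ ∃ z, ¬ P x z := inferInstance
  simpa using this

instance DefPred.eq (f g : X → M) [hf : DefFun f] [hg : DefFun g] :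
    DefPred fun x => f x = g x := by
  constructor
  exact (hf.out ()).ofPred_eq (hg.out ())

instance DefPred.mem (f g : X → M) [hf : DefFun f] [hg : DefFun g] :
    DefPred fun x => f x ∈ᴹ g x := by
  have h : DefPred fun p : M × M => p.1 ∈ᴹ p.2 := by
    constructor
    refine ⟨(FirstOrder.Language.Relations.formula₂
      ((setLang.lhomWithConstants (Set.univ : Set M)).onRelation MemRel.mem)
      (FirstOrder.Language.Term.var (some ())) (FirstOrder.Language.Term.var none)), ?_⟩
    ext v
    simp only [Set.mem_ofPred_eq, FirstOrder.Language.Formula.realize_rel₂,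
      FirstOrder.Language.Term.realize_var]
    rfl
  exact h.subst (DefFun.pair f g)

instance DefPred.exUnique (P : X → M → Prop) [hP : DefPred fun p : X × M => P p.1 p.2] :
    DefPred fun x => ∃! z, P x z := by
  have h : DefPred fun p : (X × M) × M => P p.1.1 p.2 :=
    hP.subst (f := fun p : (X × M) × M => (p.1.1, p.2)) inferInstance
  simp only [ExistsUnique]
  infer_instance

theorem DefFun.of_graph {f : X → M} (h : DefPred fun p : X × M => p.2 = f p.1) : DefFun f := by
  constructor
  intro i
  have h' := h.out
  simp only [eq_comm (b := f _)] at h'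
  exact h'

/-- The definable unary class functions. -/
class DefFun₁ (F : M → M) : Prop where
  out : DefFun F

/-- The definable binary class functions. -/
class DefFun₂ (F : M → M → M) : Prop where
  out : DefFun fun p : M × M => F p.1 p.2

instance (priority := 200) DefFun₁.app (F : M → M) (f : X → M) [hF : DefFun₁ F] [hf : DefFun f] :
    DefFun fun x => F (f x) :=
  hF.out.subst hf

instance (priority := 300) DefFun₂.app (F : M → M → M) (f g : X → M) [hF : DefFun₂ F]
    [DefFun f] [DefFun g] :
    DefFun fun x => F (f x) (g x) :=
  hF.out.subst (DefFun.pair f g)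

/-- The definable unary predicates. -/
class DefPred₁ (P : M → Prop) : Prop where
  out : DefPred P

/-- The definable binary predicates. -/
class DefPred₂ (P : M → M → Prop) : Prop where
  out : DefPred fun p : M × M => P p.1 p.2

instance (priority := 200) DefPred₁.app (P : M → Prop) (f : X → M) [hP : DefPred₁ P]
    [hf : DefFun f] :
    DefPred fun x => P (f x) :=
  hP.out.subst hf

instance (priority := 300) DefPred₂.app (P : M → M → Prop) (f g : X → M) [hP : DefPred₂ P]
    [DefFun f] [DefFun g] :
    DefPred fun x => P (f x) (g x) :=
  hP.out.subst (DefFun.pair f g)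

instance (priority := 20) DefFun₁.defFun (F : M → M) [hF : DefFun₁ F] : DefFun F := hF.out

instance (priority := 20) DefFun₂.defFun (F : M → M → M) (c : M) [DefFun₂ F] :
    DefFun fun z => F c z :=
  DefFun₂.app F (fun _ => c) fun x => x

instance (priority := 20) DefPred₁.defPred (P : M → Prop) [hP : DefPred₁ P] : DefPred P := hP.out

instance (priority := 20) DefPred₂.defPred (P : M → M → Prop) (c : M) [DefPred₂ P] :
    DefPred fun z => P c z :=
  DefPred₂.app P (fun _ => c) fun x => x

instance : DefPred₂ (Mem (M := M)) := ⟨inferInstance⟩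

instance : DefPred₂ (Eq (α := M)) := ⟨inferInstance⟩

end

section

variable {M : Type u} [setLang.Structure M]

instance : DefPred₂ (IsSubset (M := M)) := ⟨by unfold IsSubset; infer_instance⟩

instance : DefPred₁ (IsOrdinal (M := M)) := ⟨by unfold IsOrdinal; infer_instance⟩

end

/-! ### Set operations and class functions inside a model -/

section

variable {M : Type u} [setLang.Structure M]

variable [ModelsZF M]

theorem ext {a b : M} (h : ∀ z, z ∈ᴹ a ↔ z ∈ᴹ b) : a = b :=
  ModelsZF.extensionality a b h

open Classical in
/-- The unique `z` with `P z`, if there is one. -/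
noncomputable def iota (P : M → Prop) : M :=
  if h : ∃! z, P z then h.choose else (ModelsZF.infinity (M := M)).choose

theorem iota_spec {P : M → Prop} (h : ∃! z, P z) : P (iota P) := by
  rw [iota, dif_pos h]
  exact h.choose_spec.1

theorem iota_eq {P : M → Prop} {a : M} (ha : P a) (h : ∀ z, P z → z = a) : iota P = a :=
  h _ (iota_spec ⟨a, ha, h⟩)

instance DefFun.iota {X : Type u} [Context M X] (P : X → M → Prop)
    [hP : DefPred fun p : X × M => P p.1 p.2] : DefFun fun x => iota fun z => P x z := by
  apply DefFun.of_graph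
  have h₁ : DefPred fun p : X × M => ∃! z, P p.1 z := by
    have : DefPred fun x : X => ∃! z, P x z := inferInstance
    exact this.subst inferInstance
  -- Where unique existence fails, `iota` takes a fixed element of M, which is admissible as a
  -- parameter.
  have h₂ : DefPred fun p : X × M =>
      (P p.1 p.2 ∧ ∃! z, P p.1 z) ∨
        ((¬ ∃! z, P p.1 z) ∧ p.2 = (ModelsZF.infinity (M := M)).choose) := inferInstance
  convert h₂ using 2 with p
  by_cases h : ∃! z, P p.1 z
  · have := iota_spec h
    constructor
    · rintro h'
      rw [h']
      exact Or.inl ⟨this, h⟩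
    · rintro (h' | h')
      · exact h.unique h'.1 this
      · exact absurd h h'.1
  · rw [ZFModel.iota, dif_neg h]
    simp [h]

/-- The subset of `a` defined by `P`. -/
noncomputable def sep (a : M) (P : M → Prop) : M := iota fun b => ∀ z, z ∈ᴹ b ↔ z ∈ᴹ a ∧ P z

instance DefFun.sep {X : Type u} [Context M X] (f : X → M) (P : X → M → Prop) [DefFun f]
    [hP : DefPred fun p : X × M => P p.1 p.2] :
    DefFun fun x => sep (f x) fun z => P x z := by
  have : DefPred fun p : (X × M) × M => P p.1.1 p.2 :=
    hP.subst (f := fun p : (X × M) × M => (p.1.1, p.2)) inferInstance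
  have : DefFun fun p : X × M => f p.1 := DefFun.subst (g := f) inferInstance inferInstance
  have : DefFun fun p : (X × M) × M => f p.1.1 :=
    DefFun.subst (g := f) (f := fun p : (X × M) × M => p.1.1) inferInstance inferInstance
  unfold ZFModel.sep
  infer_instance

theorem iota_set {P : M → Prop} (h : ∃ b, ∀ z, z ∈ᴹ b ↔ P z) (z : M) :
    z ∈ᴹ iota (fun b => ∀ z, z ∈ᴹ b ↔ P z) ↔ P z := by
  obtain ⟨b, hb⟩ := h
  rw [iota_eq hb fun c hc => ext fun w => by rw [hc, hb]]
  exact hb z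

-- Definability is only an instance argument, so Separation applies like naive comprehension. The
-- last step of the proof renames the single variable from `Unit` to the `Fin 1` of the schema.
@[simp]
theorem mem_sep (P : M → Prop) [hP : DefPred P] (a z : M) : z ∈ᴹ sep a P ↔ z ∈ᴹ a ∧ P z := by
  refine iota_set ?_ z
  refine ModelsZF.separation {z | P z} ?_ a
  exact hP.out.preimage_comp (fun _ : Unit => (0 : Fin 1))

/-- The image of `a` under `F`. -/
noncomputable def image (a : M) (F : M → M) : M :=
  iota fun b => ∀ z, z ∈ᴹ b ↔ ∃ y, y ∈ᴹ a ∧ z = F y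

instance DefFun.image {X : Type u} [Context M X] (f : X → M) (F : X → M → M) [DefFun f]
    [hF : DefFun fun p : X × M => F p.1 p.2] :
    DefFun fun x => image (f x) fun z => F x z := by
  have : DefFun fun p : ((X × M) × M) × M => F p.1.1.1 p.2 :=
    hF.subst (f := fun p : ((X × M) × M) × M => (p.1.1.1, p.2)) inferInstance
  have : DefFun fun p : ((X × M) × M) × M => f p.1.1.1 :=
    DefFun.subst (g := f) (f := fun p : ((X × M) × M) × M => p.1.1.1) inferInstance inferInstance
  unfold ZFModel.image
  infer_instance

@[simp]
theorem mem_image (F : M → M) [hF : DefFun F] (a z : M) :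
    z ∈ᴹ image a F ↔ ∃ y, y ∈ᴹ a ∧ z = F y := by
  refine iota_set ?_ z
  refine ModelsZF.replacement {p | p.2 = F p.1} ?_ a fun y _ => ⟨F y, rfl, fun _ h => h⟩
  have : DefPred fun p : M × M => p.2 = F p.1 := by
    have : DefFun fun p : M × M => F p.1 := hF.subst inferInstance
    infer_instance
  exact this.out.preimage_comp fun i : Option Unit => i.elim (1 : Fin 2) fun _ => 0

/-- The empty set. -/
noncomputable def emp : M := iota fun e : M => ∀ z, z ∈ᴹ e ↔ False

@[simp]
theorem not_mem_emp (z : M) : ¬ z ∈ᴹ emp := by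
  refine (iota_set ?_ z).1
  obtain ⟨b, hb⟩ := ModelsZF.separation {z : M | False} (DefPred.const (X := M) False |>.out.preimage_comp
    (fun _ : Unit => (0 : Fin 1))) (ModelsZF.infinity (M := M)).choose
  exact ⟨b, fun z => by simpa using hb z⟩

/-- The unordered pair `{a, b}`. -/
noncomputable def upair (a b : M) : M := iota fun c => ∀ z, z ∈ᴹ c ↔ z = a ∨ z = b

instance : DefFun₂ (upair (M := M)) := ⟨by unfold upair; infer_instance⟩

@[simp]
theorem mem_upair (a b z : M) : z ∈ᴹ upair a b ↔ z = a ∨ z = b :=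
  iota_set (ModelsZF.pairing a b) z

/-- The union of the elements of `a`. -/
noncomputable def sUnion (a : M) : M := iota fun c => ∀ z, z ∈ᴹ c ↔ ∃ y, y ∈ᴹ a ∧ z ∈ᴹ y

instance : DefFun₁ (sUnion (M := M)) := ⟨by unfold sUnion; infer_instance⟩

@[simp]
theorem mem_sUnion (a z : M) : z ∈ᴹ sUnion a ↔ ∃ y, y ∈ᴹ a ∧ z ∈ᴹ y :=
  iota_set (ModelsZF.union a) z

/-- The union `a ∪ b`. -/
noncomputable def union (a b : M) : M := sUnion (upair a b)

instance : DefFun₂ (union (M := M)) := ⟨by unfold union; infer_instance⟩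

@[simp]
theorem mem_union (a b z : M) : z ∈ᴹ union a b ↔ z ∈ᴹ a ∨ z ∈ᴹ b := by
  simp [union]

/-- The singleton `{a}`. -/
noncomputable def sing (a : M) : M := upair a a

instance : DefFun₁ (sing (M := M)) := ⟨by unfold sing; infer_instance⟩

@[simp]
theorem mem_sing (a z : M) : z ∈ᴹ sing a ↔ z = a := by
  simp [sing]

/-- The successor `a ∪ {a}`. -/
noncomputable def succ (a : M) : M := union a (sing a)

instance : DefFun₁ (succ (M := M)) := ⟨by unfold succ; infer_instance⟩

@[simp]
theorem mem_succ (a z : M) : z ∈ᴹ succ a ↔ z ∈ᴹ a ∨ z = a := by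
  simp [succ]

@[simp]
theorem mem_pow_iff (a z : M) : z ∈ᴹ pow a ↔ ∀ w, w ∈ᴹ z → w ∈ᴹ a := mem_pow a z

instance : DefFun₁ (pow (M := M)) := by
  refine ⟨DefFun.of_graph ?_⟩
  have : DefPred fun p : M × M => ∀ z, z ∈ᴹ p.2 ↔ ∀ w, w ∈ᴹ z → w ∈ᴹ p.1 := inferInstance
  convert this using 2 with p
  constructor
  · rintro h z
    rw [h, mem_pow_iff]
  · intro h
    exact ext fun z => by rw [h, mem_pow_iff]

/-- The ordered pair `(a, b)`. -/
noncomputable def pair (a b : M) : M := upair (sing a) (upair a b)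

instance : DefFun₂ (pair (M := M)) := ⟨by unfold pair; infer_instance⟩

theorem upair_eq_sing {a b c : M} (h : upair a b = sing c) : a = c ∧ b = c := by
  constructor
  · rw [← mem_sing, ← h]
    simp
  · rw [← mem_sing, ← h]
    simp

theorem upair_left_cancel {a b c : M} (h : upair a b = upair a c) : b = c := by
  have h₁ : b = a ∨ b = c := by
    rw [← mem_upair, ← h]
    simp
  have h₂ : c = a ∨ c = b := by
    rw [← mem_upair, h]
    simp
  grind

@[simp]
theorem pair_inj {a b c d : M} : pair a b = pair c d ↔ a = c ∧ b = d := by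
  constructor
  · intro h
    have h₁ : sing a = sing c ∨ sing a = upair c d := by
      rw [← mem_upair, ← pair, ← h, pair]
      simp
    have hac : a = c := by
      rcases h₁ with h₁ | h₁
      · exact (upair_eq_sing h₁).1
      · exact (upair_eq_sing h₁.symm).1.symm
    subst hac
    exact ⟨rfl, upair_left_cancel (upair_left_cancel h)⟩
  · rintro ⟨rfl, rfl⟩
    rfl

theorem isUPair_iff (c a b : M) : IsUPair c a b ↔ c = upair a b := by
  constructor
  · intro h
    exact ext fun z => by rw [h z, mem_upair]
  · rintro rfl
    exact mem_upair a b

theorem isOPair_iff (p a b : M) : IsOPair p a b ↔ p = pair a b := by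
  simp only [IsOPair, isUPair_iff]
  constructor
  · intro h
    exact ext fun z => by rw [h z, pair, mem_upair, sing]
  · rintro rfl z
    rw [pair, mem_upair, sing]

theorem rel_iff (f a b : M) : Rel f a b ↔ pair a b ∈ᴹ f := by
  simp [Rel, isOPair_iff]

theorem isFunction_iff (f a b : M) : IsFunction f a b ↔
    (∀ p, p ∈ᴹ f → ∃ y z, y ∈ᴹ a ∧ z ∈ᴹ b ∧ p = pair y z) ∧
      ∀ y, y ∈ᴹ a → ∃! z, pair y z ∈ᴹ f := by
  simp only [IsFunction, rel_iff, isOPair_iff]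

/-- The Cartesian product `a × b`. -/
noncomputable def prod (a b : M) : M :=
  sUnion (image a fun y => image b fun z => pair y z)

instance : DefFun₂ (prod (M := M)) := ⟨by unfold prod; infer_instance⟩

@[simp]
theorem mem_prod (a b p : M) : p ∈ᴹ prod a b ↔ ∃ y, y ∈ᴹ a ∧ ∃ z, z ∈ᴹ b ∧ p = pair y z := by
  rw [prod, mem_sUnion]
  simp only [mem_image]
  constructor
  · rintro ⟨_, ⟨y, hy, rfl⟩, h⟩
    exact ⟨y, hy, by simpa using h⟩
  · rintro ⟨y, hy, h⟩
    exact ⟨_, ⟨y, hy, rfl⟩, by simpa using h⟩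

/-- The first component of an ordered pair. -/
noncomputable def fst (p : M) : M := iota fun y => ∃ z, p = pair y z

/-- The second component of an ordered pair. -/
noncomputable def snd (p : M) : M := iota fun z => ∃ y, p = pair y z

instance : DefFun₁ (fst (M := M)) := ⟨by unfold fst; infer_instance⟩

instance : DefFun₁ (snd (M := M)) := ⟨by unfold snd; infer_instance⟩

@[simp]
theorem fst_pair (a b : M) : fst (pair a b) = a :=
  iota_eq ⟨b, rfl⟩ fun _ ⟨_, h⟩ => (pair_inj.1 h).1.symm

@[simp]
theorem snd_pair (a b : M) : snd (pair a b) = b :=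
  iota_eq ⟨a, rfl⟩ fun _ ⟨_, h⟩ => (pair_inj.1 h).2.symm

/-- The restriction of the class function `F` to `a`, as a set of ordered pairs. -/
noncomputable def lam (a : M) (F : M → M) : M := image a fun z => pair z (F z)

instance DefFun.lam {X : Type u} [Context M X] (f : X → M) (F : X → M → M) [DefFun f]
    [hF : DefFun fun p : X × M => F p.1 p.2] :
    DefFun fun x => lam (f x) fun z => F x z := by
  unfold ZFModel.lam
  infer_instance

theorem pair_mem_lam (a : M) (F : M → M) [DefFun F] (y z : M) :
    pair y z ∈ᴹ lam a F ↔ y ∈ᴹ a ∧ z = F y := by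
  simp [lam]

/-- The value of the function `f`, a set of ordered pairs, at `z`. -/
noncomputable def app (f z : M) : M := iota fun y => pair z y ∈ᴹ f

instance : DefFun₂ (app (M := M)) := ⟨by unfold app; infer_instance⟩

theorem app_lam (a : M) (F : M → M) [DefFun F] {z : M} (hz : z ∈ᴹ a) : app (lam a F) z = F z :=
  iota_eq ((pair_mem_lam a F z _).2 ⟨hz, rfl⟩) fun w hw => ((pair_mem_lam a F z w).1 hw).2

theorem lam_congr (a : M) (F G : M → M) [DefFun F] [DefFun G] (h : ∀ z, z ∈ᴹ a → F z = G z) :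
    lam a F = lam a G := by
  refine ext fun p => ?_
  simp only [lam, mem_image]
  constructor
  · rintro ⟨y, hy, rfl⟩
    exact ⟨y, hy, by rw [h y hy]⟩
  · rintro ⟨y, hy, rfl⟩
    exact ⟨y, hy, by rw [h y hy]⟩

instance DefFun.ite {X : Type u} [Context M X] (P : X → Prop) (f g : X → M)
    [∀ x, Decidable (P x)] [DefPred P] [DefFun f] [DefFun g] :
    DefFun fun x => if P x then f x else g x := by
  apply DefFun.of_graph
  have : DefPred fun p : X × M => P p.1 := DefPred.subst (Q := P) inferInstance inferInstance
  have : DefFun fun p : X × M => f p.1 := DefFun.subst (g := f) inferInstance inferInstance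
  have : DefFun fun p : X × M => g p.1 := DefFun.subst (g := g) inferInstance inferInstance
  have h : DefPred fun p : X × M => (P p.1 ∧ p.2 = f p.1) ∨ (¬ P p.1 ∧ p.2 = g p.1) :=
    inferInstance
  convert h using 2 with p
  by_cases h : P p.1 <;> simp [h]

end

/-! ### Comparison of cardinalities -/

section

variable {M : Type u} [setLang.Structure M]

theorem Equinumerous.dominated {a b : M} (h : Equinumerous a b) : Dominated a b :=
  h.imp fun _ hf => hf.1

variable [ModelsZF M]

theorem isInjection_iff (f a b : M) : IsInjection f a b ↔
    IsFunction f a b ∧ ∀ y y' z, pair y z ∈ᴹ f → pair y' z ∈ᴹ f → y = y' := by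
  simp only [IsInjection, rel_iff]

theorem isFunction_lam {a b : M} (F : M → M) [DefFun F] (h : ∀ z, z ∈ᴹ a → F z ∈ᴹ b) :
    IsFunction (lam a F) a b := by
  rw [isFunction_iff]
  constructor
  · intro p hp
    rw [lam, mem_image] at hp
    obtain ⟨y, hy, rfl⟩ := hp
    exact ⟨y, F y, hy, h y hy, rfl⟩
  · intro y hy
    refine ⟨F y, ?_, ?_⟩ <;> simp [pair_mem_lam, hy]

theorem isInjection_lam {a b : M} (F : M → M) [DefFun F] (h : ∀ z, z ∈ᴹ a → F z ∈ᴹ b)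
    (h' : ∀ y z, y ∈ᴹ a → z ∈ᴹ a → F y = F z → y = z) : IsInjection (lam a F) a b := by
  rw [isInjection_iff]
  refine ⟨isFunction_lam F h, ?_⟩
  simp only [pair_mem_lam]
  rintro y y' _ ⟨hy, rfl⟩ ⟨hy', h⟩
  exact h' y y' hy hy' h

theorem dominated_of {a b : M} (F : M → M) [DefFun F] (h : ∀ z, z ∈ᴹ a → F z ∈ᴹ b)
    (h' : ∀ y z, y ∈ᴹ a → z ∈ᴹ a → F y = F z → y = z) : Dominated a b :=
  ⟨_, isInjection_lam F h h'⟩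

theorem equinumerous_of {a b : M} (F : M → M) [DefFun F] (h : ∀ z, z ∈ᴹ a → F z ∈ᴹ b)
    (h' : ∀ y z, y ∈ᴹ a → z ∈ᴹ a → F y = F z → y = z)
    (h'' : ∀ z, z ∈ᴹ b → ∃ y, y ∈ᴹ a ∧ F y = z) : Equinumerous a b := by
  refine ⟨_, isInjection_lam F h h', fun z hz => ?_⟩
  obtain ⟨y, hy, rfl⟩ := h'' z hz
  exact ⟨y, by simp [rel_iff, pair_mem_lam, hy]⟩

theorem app_eq {f a b y z : M} (h : IsFunction f a b) (hyz : pair y z ∈ᴹ f) : app f y = z := by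
  rw [isFunction_iff] at h
  obtain ⟨y', z', hy, -, hp⟩ := h.1 _ hyz
  rw [pair_inj] at hp
  exact iota_eq hyz fun w hw => (h.2 y (hp.1 ▸ hy)).unique hw hyz

theorem pair_app_mem {f a b y : M} (h : IsFunction f a b) (hy : y ∈ᴹ a) :
    pair y (app f y) ∈ᴹ f :=
  iota_spec (((isFunction_iff f a b).1 h).2 y hy)

theorem app_mem {f a b y : M} (h : IsFunction f a b) (hy : y ∈ᴹ a) : app f y ∈ᴹ b := by
  obtain ⟨y', z', -, hz, hp⟩ := ((isFunction_iff f a b).1 h).1 _ (pair_app_mem h hy)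
  rw [pair_inj] at hp
  exact hp.2 ▸ hz

theorem app_injOn {f a b y z : M} (h : IsInjection f a b) (hy : y ∈ᴹ a) (hz : z ∈ᴹ a)
    (hyz : app f y = app f z) : y = z :=
  ((isInjection_iff f a b).1 h).2 y z _ (pair_app_mem h.1 hy) (hyz ▸ pair_app_mem h.1 hz)

theorem Dominated.exists_fun {a b : M} (h : Dominated a b) : ∃ F : M → M, DefFun₁ F ∧
    (∀ z, z ∈ᴹ a → F z ∈ᴹ b) ∧ ∀ y z, y ∈ᴹ a → z ∈ᴹ a → F y = F z → y = z := by
  obtain ⟨f, hf⟩ := h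
  exact ⟨fun z => app f z, ⟨inferInstance⟩, fun z hz => app_mem hf.1 hz,
    fun y z hy hz => app_injOn hf hy hz⟩

instance : DefPred₂ (Dominated (M := M)) := by
  constructor
  simp only [Dominated, isInjection_iff, isFunction_iff]
  infer_instance

/-- The inverse of `F` on `a`. -/
noncomputable def inv (a : M) (F : M → M) (y : M) : M := iota fun z => z ∈ᴹ a ∧ F z = y

instance (a : M) (F : M → M) [DefFun₁ F] : DefFun₁ (inv a F) :=
  ⟨by unfold inv; infer_instance⟩

theorem inv_apply {a z : M} {F : M → M} (h : ∀ y z, y ∈ᴹ a → z ∈ᴹ a → F y = F z → y = z)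
    (hz : z ∈ᴹ a) : inv a F (F z) = z :=
  iota_eq ⟨hz, rfl⟩ fun w hw => h w z hw.1 hz hw.2

theorem Equinumerous.dominated_symm {a b : M} (h : Equinumerous a b) : Dominated b a := by
  obtain ⟨f, hf, hs⟩ := h
  have hs' : ∀ z, z ∈ᴹ b → ∃ y, y ∈ᴹ a ∧ app f y = z := by
    intro z hz
    obtain ⟨y, hy⟩ := hs z hz
    rw [rel_iff] at hy
    obtain ⟨y', z', hy', -, hp⟩ := ((isFunction_iff f a b).1 hf.1).1 _ hy
    exact ⟨y, (pair_inj.1 hp).1 ▸ hy', app_eq hf.1 hy⟩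
  have : DefFun₁ fun z => app f z := ⟨inferInstance⟩
  have hinj : ∀ y z, y ∈ᴹ a → z ∈ᴹ a → app f y = app f z → y = z :=
    fun y z hy hz => app_injOn hf hy hz
  refine dominated_of (inv a fun z => app f z) ?_ ?_
  · intro z hz
    obtain ⟨y, hy, rfl⟩ := hs' z hz
    rwa [inv_apply hinj hy]
  · intro y z hy hz h
    obtain ⟨y', hy', rfl⟩ := hs' y hy
    obtain ⟨z', hz', rfl⟩ := hs' z hz
    rw [inv_apply hinj hy', inv_apply hinj hz'] at h
    rw [h]

theorem Dominated.of_subset {a b : M} (h : ∀ z, z ∈ᴹ a → z ∈ᴹ b) : Dominated a b :=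
  dominated_of (fun z => z) h fun _ _ _ _ h => h

theorem Dominated.trans {a b c : M} (h₁ : Dominated a b) (h₂ : Dominated b c) :
    Dominated a c := by
  obtain ⟨F, _, hF, hF'⟩ := h₁.exists_fun
  obtain ⟨G, _, hG, hG'⟩ := h₂.exists_fun
  exact dominated_of (fun z => G (F z)) (fun z hz => hG _ (hF z hz))
    fun y z hy hz h => hF' y z hy hz (hG' _ _ (hF y hy) (hF z hz) h)

open Classical in
/-- The Cantor–Bernstein theorem. -/
theorem Equinumerous.of_dominated {a b : M} (h₁ : Dominated a b) (h₂ : Dominated b a) :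
    Equinumerous a b := by
  obtain ⟨F, _, hF, hF'⟩ := h₁.exists_fun
  obtain ⟨G, _, hG, hG'⟩ := h₂.exists_fun
  -- The least set that contains a minus the range of G and is closed under G ∘ F. The bijection is
  -- F on it and the inverse of G off it.
  let S : M := sep a fun z => ∀ s, (∀ z, z ∈ᴹ a → (∀ y, y ∈ᴹ b → z ≠ G y) → z ∈ᴹ s) →
    (∀ z, z ∈ᴹ s → G (F z) ∈ᴹ s) → z ∈ᴹ s
  have hS : ∀ z, z ∈ᴹ S ↔ z ∈ᴹ a ∧ ∀ s, (∀ z, z ∈ᴹ a → (∀ y, y ∈ᴹ b → z ≠ G y) → z ∈ᴹ s) →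
    (∀ z, z ∈ᴹ s → G (F z) ∈ᴹ s) → z ∈ᴹ s := fun z => mem_sep _ a z
  have hS₁ : ∀ z, z ∈ᴹ a → (∀ y, y ∈ᴹ b → z ≠ G y) → z ∈ᴹ S :=
    fun z hz h => (hS z).2 ⟨hz, fun s h₁ _ => h₁ z hz h⟩
  have hS₂ : ∀ z, z ∈ᴹ S → G (F z) ∈ᴹ S := fun z hz => (hS _).2
    ⟨hG _ (hF _ ((hS z).1 hz).1), fun s h₁ h₂ => h₂ z (((hS z).1 hz).2 s h₁ h₂)⟩
  have hS₃ : ∀ y, y ∈ᴹ b → G y ∈ᴹ S → ∃ z, z ∈ᴹ S ∧ y = F z := by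
    intro y hy hyS
    by_contra! hne
    -- If y were not in F[S], removing G y from S would leave a smaller set with the same closure
    -- properties.
    have := ((hS _).1 hyS).2 (sep S fun z => z ≠ G y)
      (fun z hz h => (mem_sep _ _ _).2 ⟨hS₁ z hz h, h y hy⟩) fun z hz => by
        rw [mem_sep] at hz ⊢
        refine ⟨hS₂ z hz.1, fun h => hne z hz.1 ?_⟩
        exact (hG' _ _ (hF z ((hS z).1 hz.1).1) hy h).symm
    rw [mem_sep] at this
    exact this.2 rfl
  have hS₄ : ∀ z, z ∈ᴹ a → ¬ z ∈ᴹ S → ∃ y, y ∈ᴹ b ∧ z = G y := by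
    intro z hz h
    by_contra! h'
    exact h (hS₁ z hz h')
  refine equinumerous_of (fun z => if z ∈ᴹ S then F z else inv b G z) ?_ ?_ ?_
  · intro z hz
    by_cases h : z ∈ᴹ S
    · simpa [h] using hF z hz
    · obtain ⟨y, hy, rfl⟩ := hS₄ z hz h
      simpa [h, inv_apply hG' hy] using hy
  · have key : ∀ y z, y ∈ᴹ S → z ∈ᴹ a → ¬ z ∈ᴹ S → F y ≠ inv b G z := by
      intro y z hy hz hzS h
      obtain ⟨w, hw, rfl⟩ := hS₄ z hz hzS
      rw [inv_apply hG' hw] at h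
      exact hzS (h ▸ hS₂ y hy)
    intro y z hy hz h
    by_cases hyS : y ∈ᴹ S <;> by_cases hzS : z ∈ᴹ S <;> simp only [hyS, hzS, if_true, if_false] at h
    · exact hF' y z hy hz h
    · exact (key y z hyS hz hzS h).elim
    · exact (key z y hzS hy hyS h.symm).elim
    · obtain ⟨v, hv, rfl⟩ := hS₄ y hy hyS
      obtain ⟨w, hw, rfl⟩ := hS₄ z hz hzS
      rw [inv_apply hG' hv, inv_apply hG' hw] at h
      rw [h]
  · intro y hy
    by_cases h : G y ∈ᴹ S
    · obtain ⟨z, hz, rfl⟩ := hS₃ y hy h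
      exact ⟨z, ((hS z).1 hz).1, by simp [hz]⟩
    · exact ⟨G y, hG y hy, by simp [h, inv_apply hG' hy]⟩

/-- Cantor's theorem for functions on a subset. -/
theorem exists_not_mem_range (a : M) (F : M → M) [DefFun F] :
    ∃ c, c ∈ᴹ pow a ∧ ∀ z, z ∈ᴹ a → F z ≠ c := by
  refine ⟨sep a fun z => ¬ z ∈ᴹ F z, by simp +contextual, fun z hz h => ?_⟩
  have := mem_sep (fun z => ¬ z ∈ᴹ F z) a z
  rw [← h] at this
  tauto

theorem not_pow_dominated (a : M) : ¬ Dominated (pow a) a := by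
  intro h
  obtain ⟨F, _, hF, hF'⟩ := h.exists_fun
  obtain ⟨c, hc, h⟩ := exists_not_mem_range a (inv (pow a) F)
  exact h (F c) (hF c hc) (inv_apply hF' hc)

theorem Dominated.pow {a b : M} (h : Dominated a b) : Dominated (pow a) (pow b) := by
  obtain ⟨F, _, hF, hF'⟩ := h.exists_fun
  refine dominated_of (fun s => image s F) ?_ ?_
  · intro s hs
    simp only [mem_pow_iff, mem_image] at hs ⊢
    rintro _ ⟨y, hy, rfl⟩
    exact hF y (hs y hy)
  · intro s t hs ht h
    rw [mem_pow_iff] at hs ht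
    have key : ∀ s t, (∀ w, w ∈ᴹ s → w ∈ᴹ a) → (∀ w, w ∈ᴹ t → w ∈ᴹ a) →
        image s F = image t F → ∀ z, z ∈ᴹ s → z ∈ᴹ t := by
      intro s t hs ht h z hz
      have : F z ∈ᴹ image t F := h ▸ (mem_image F s _).2 ⟨z, hz, rfl⟩
      obtain ⟨w, hw, hzw⟩ := (mem_image F t _).1 this
      rwa [hF' z w (hs z hz) (ht w hw) hzw]
    exact ext fun z => ⟨key s t hs ht h z, key t s ht hs h.symm z⟩

theorem dominated_pow (a : M) : Dominated a (pow a) := by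
  refine dominated_of (fun z => sing z) (by simp) ?_
  intro y z _ _ h
  rw [← mem_sing, ← h, mem_sing]

/-! ### Disjoint unions and products -/

/-- The left tag of a disjoint union. -/
noncomputable def inl (z : M) : M := pair emp z

/-- The right tag of a disjoint union. -/
noncomputable def inr (z : M) : M := pair (sing emp) z

instance : DefFun₁ (inl (M := M)) := ⟨by unfold inl; infer_instance⟩

instance : DefFun₁ (inr (M := M)) := ⟨by unfold inr; infer_instance⟩

theorem sing_ne_emp (z : M) : sing z ≠ emp := fun h => not_mem_emp z (h ▸ (mem_sing z z).2 rfl)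

@[simp]
theorem inl_inj {y z : M} : inl y = inl z ↔ y = z := by simp [inl]

@[simp]
theorem inr_inj {y z : M} : inr y = inr z ↔ y = z := by simp [inr]

@[simp]
theorem inl_ne_inr (y z : M) : inl y ≠ inr z := by simp [inl, inr, (sing_ne_emp emp).symm]

@[simp]
theorem inr_ne_inl (y z : M) : inr y ≠ inl z := (inl_ne_inr z y).symm

/-- The disjoint union of `a` and `b`. -/
noncomputable def sum (a b : M) : M := union (image a inl) (image b inr)

theorem mem_sum (a b p : M) : p ∈ᴹ sum a b ↔
    (∃ z, z ∈ᴹ a ∧ p = inl z) ∨ ∃ z, z ∈ᴹ b ∧ p = inr z := by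
  simp [sum]

@[simp]
theorem inl_mem_sum (a b z : M) : inl z ∈ᴹ sum a b ↔ z ∈ᴹ a := by
  simp [mem_sum]

@[simp]
theorem inr_mem_sum (a b z : M) : inr z ∈ᴹ sum a b ↔ z ∈ᴹ b := by
  simp [mem_sum]

theorem dominated_sum_left (a b : M) : Dominated a (sum a b) :=
  dominated_of inl (by simp) (by simp)

theorem dominated_sum_right (a b : M) : Dominated b (sum a b) :=
  dominated_of inr (by simp) (by simp)

open Classical in
theorem Dominated.sum {a b c d : M} (h₁ : Dominated a c) (h₂ : Dominated b d) :
    Dominated (sum a b) (sum c d) := by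
  obtain ⟨F, _, hF, hF'⟩ := h₁.exists_fun
  obtain ⟨G, _, hG, hG'⟩ := h₂.exists_fun
  let H : M → M := fun p => if fst p = emp then inl (F (snd p)) else inr (G (snd p))
  have hl : ∀ z, H (inl z) = inl (F z) := by simp [H, inl]
  have hr : ∀ z, H (inr z) = inr (G z) := by simp [H, inr, sing_ne_emp]
  have : DefFun H := by
    unfold H
    infer_instance
  refine dominated_of H ?_ ?_
  · simp only [mem_sum]
    rintro _ (⟨z, hz, rfl⟩ | ⟨z, hz, rfl⟩)
    · exact Or.inl ⟨_, hF z hz, hl z⟩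
    · exact Or.inr ⟨_, hG z hz, hr z⟩
  · simp only [mem_sum]
    rintro _ _ (⟨y, hy, rfl⟩ | ⟨y, hy, rfl⟩) (⟨z, hz, rfl⟩ | ⟨z, hz, rfl⟩) h <;>
      simp only [hl, hr, inl_inj, inr_inj, inl_ne_inr, inr_ne_inl] at h
    · rw [hF' y z hy hz h]
    · rw [hG' y z hy hz h]

theorem Dominated.prod {a b c d : M} (h₁ : Dominated a c) (h₂ : Dominated b d) :
    Dominated (prod a b) (prod c d) := by
  obtain ⟨F, _, hF, hF'⟩ := h₁.exists_fun
  obtain ⟨G, _, hG, hG'⟩ := h₂.exists_fun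
  refine dominated_of (fun p => pair (F (fst p)) (G (snd p))) ?_ ?_
  · simp only [mem_prod]
    rintro _ ⟨y, hy, z, hz, rfl⟩
    exact ⟨_, hF y hy, _, hG z hz, by simp⟩
  · simp only [mem_prod]
    rintro _ _ ⟨y, hy, z, hz, rfl⟩ ⟨y', hy', z', hz', rfl⟩ h
    simp only [fst_pair, snd_pair, pair_inj] at h
    rw [hF' y y' hy hy' h.1, hG' z z' hz hz' h.2]

open Classical in
theorem sum_self_dominated_prod {a u v : M} (hu : u ∈ᴹ a) (hv : v ∈ᴹ a) (huv : u ≠ v) :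
    Dominated (sum a a) (prod a a) := by
  let H : M → M := fun p => pair (if fst p = emp then u else v) (snd p)
  have hl : ∀ z, H (inl z) = pair u z := by simp [H, inl]
  have hr : ∀ z, H (inr z) = pair v z := by simp [H, inr, sing_ne_emp]
  have : DefFun H := by
    unfold H
    infer_instance
  refine dominated_of H ?_ ?_
  · simp only [mem_sum, mem_prod]
    rintro _ (⟨z, hz, rfl⟩ | ⟨z, hz, rfl⟩)
    · exact ⟨_, hu, z, hz, hl z⟩
    · exact ⟨_, hv, z, hz, hr z⟩
  · simp only [mem_sum]
    rintro _ _ (⟨y, hy, rfl⟩ | ⟨y, hy, rfl⟩) (⟨z, hz, rfl⟩ | ⟨z, hz, rfl⟩) h <;>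
      simp_all [Ne.symm huv]

/-- Two subsets of a are the two traces of one subset of the disjoint union. -/
theorem prod_pow_dominated (a : M) : Dominated (prod (pow a) (pow a)) (pow (sum a a)) := by
  have hl : ∀ y z t : M, inl t ∈ᴹ union (image y inl) (image z inr) ↔ t ∈ᴹ y := by simp
  have hr : ∀ y z t : M, inr t ∈ᴹ union (image y inl) (image z inr) ↔ t ∈ᴹ z := by simp
  refine dominated_of (fun p => union (image (fst p) inl) (image (snd p) inr)) ?_ ?_
  · simp only [mem_prod]
    rintro _ ⟨y, hy, z, hz, rfl⟩
    rw [mem_pow_iff] at hy hz ⊢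
    simp only [fst_pair, snd_pair, mem_union, mem_image, mem_sum]
    rintro _ (⟨w, hw, rfl⟩ | ⟨w, hw, rfl⟩)
    · exact Or.inl ⟨w, hy w hw, rfl⟩
    · exact Or.inr ⟨w, hz w hw, rfl⟩
  · simp only [mem_prod]
    rintro _ _ ⟨y, hy, z, hz, rfl⟩ ⟨y', hy', z', hz', rfl⟩ h
    simp only [fst_pair, snd_pair] at h
    rw [pair_inj]
    constructor
    · exact ext fun t => by rw [← hl y z, h, hl]
    · exact ext fun t => by rw [← hr y z, h, hr]

/-- If `𝒫 x × 𝒫 x` injects into a disjoint union of `x` and `q`, then `𝒫 x` injects into `q`. -/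
theorem pow_dominated_of_sum {x q : M} (h₁ : Dominated (prod (pow x) (pow x)) (pow x))
    (h₂ : Dominated (pow x) (sum x q)) : Dominated (pow x) q := by
  obtain ⟨F, _, hF, hF'⟩ := (h₁.trans h₂).exists_fun
  -- Send z in x to the first component of the pair that F maps to `inl z`. By Cantor some c is
  -- missed, so F maps the whole row {c} × 𝒫x into the copy of q.
  obtain ⟨c, hc, h⟩ := exists_not_mem_range x
    (fun z => fst (inv (prod (pow x) (pow x)) F (inl z)))
  have hmem : ∀ y, y ∈ᴹ pow x → pair c y ∈ᴹ prod (pow x) (pow x) :=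
    fun y hy => (mem_prod _ _ _).2 ⟨c, hc, y, hy, rfl⟩
  have key : ∀ y, y ∈ᴹ pow x → ∃ z, z ∈ᴹ q ∧ F (pair c y) = inr z := by
    intro y hy
    rcases (mem_sum _ _ _).1 (hF _ (hmem y hy)) with ⟨z, hz, hz'⟩ | h
    · refine (h z hz ?_).elim
      rw [← hz', inv_apply hF' (hmem y hy), fst_pair]
    · exact h
  have hsnd : ∀ z : M, snd (inr z) = z := by simp [inr]
  refine dominated_of (fun y => snd (F (pair c y))) ?_ ?_
  · intro y hy
    obtain ⟨z, hz, h⟩ := key y hy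
    rwa [h, hsnd]
  · intro y y' hy hy' he
    obtain ⟨z, hz, h⟩ := key y hy
    obtain ⟨z', hz', h'⟩ := key y' hy'
    rw [h, h', hsnd, hsnd] at he
    have := hF' _ _ (hmem y hy) (hmem y' hy') (by rw [h, h', he])
    exact (pair_inj.1 this).2

end

/-! ### Foundation and the natural numbers of the model -/

section

variable {M : Type u} [setLang.Structure M]

theorem IsOrdinal.mem_trans {a b c : M} (h : IsOrdinal a) (hb : b ∈ᴹ a) (hc : c ∈ᴹ b) :
    c ∈ᴹ a := h.1 b hb c hc

variable [ModelsZF M]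

theorem mem_asymm {a b : M} (h₁ : a ∈ᴹ b) (h₂ : b ∈ᴹ a) : False := by
  obtain ⟨y, hy, h⟩ := ModelsZF.foundation (upair a b) ⟨a, by simp⟩
  rcases (mem_upair a b y).1 hy with rfl | rfl
  · exact h b (by simp) h₂
  · exact h a (by simp) h₁

theorem mem_irrefl (a : M) : ¬ a ∈ᴹ a := fun h => mem_asymm h h

theorem mem_cycle₃ {a b c : M} (h₁ : a ∈ᴹ b) (h₂ : b ∈ᴹ c) (h₃ : c ∈ᴹ a) : False := by
  obtain ⟨y, hy, h⟩ := ModelsZF.foundation (union (upair a b) (sing c)) ⟨a, by simp⟩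
  simp only [mem_union, mem_upair, mem_sing] at hy h
  rcases hy with (rfl | rfl) | rfl
  · exact h c (Or.inr rfl) h₃
  · exact h a (Or.inl (Or.inl rfl)) h₁
  · exact h b (Or.inl (Or.inr rfl)) h₂

theorem succ_inj {a b : M} (h : succ a = succ b) : a = b := by
  have h₁ : a ∈ᴹ b ∨ a = b := by
    rw [← mem_succ, ← h]
    simp
  have h₂ : b ∈ᴹ a ∨ b = a := by
    rw [← mem_succ, h]
    simp
  rcases h₁ with h₁ | h₁
  · rcases h₂ with h₂ | h₂
    · exact (mem_asymm h₁ h₂).elim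
    · exact h₂.symm
  · exact h₁

theorem succ_ne_emp (a : M) : succ a ≠ emp := fun h => not_mem_emp a (h ▸ by simp)

theorem isEmptySet_iff (e : M) : IsEmptySet e ↔ e = emp := by
  constructor
  · intro h
    exact ext fun z => by simp [h z]
  · rintro rfl
    exact not_mem_emp

theorem isSucc_iff (s n : M) : IsSucc s n ↔ s = succ n := by
  constructor
  · intro h
    exact ext fun z => by rw [h z, mem_succ]
  · rintro rfl
    exact mem_succ n

theorem isInductive_iff (i : M) :
    IsInductive i ↔ emp ∈ᴹ i ∧ ∀ n, n ∈ᴹ i → succ n ∈ᴹ i := by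
  simp [IsInductive, isEmptySet_iff, isSucc_iff]

section Omega

variable {w : M}

theorem IsOmega.emp_mem (hw : IsOmega w) : emp ∈ᴹ w :=
  (hw _).2 fun i hi => ((isInductive_iff i).1 hi).1

theorem IsOmega.succ_mem (hw : IsOmega w) {n : M} (hn : n ∈ᴹ w) : succ n ∈ᴹ w :=
  (hw _).2 fun i hi => ((isInductive_iff i).1 hi).2 n ((hw n).1 hn i hi)

theorem IsOmega.induction (hw : IsOmega w) (P : M → Prop) [DefPred P] (h₀ : P emp)
    (h : ∀ n, n ∈ᴹ w → P n → P (succ n)) {n : M} (hn : n ∈ᴹ w) : P n := by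
  have hi : IsInductive (sep w P) := by
    rw [isInductive_iff]
    simp only [mem_sep]
    exact ⟨⟨hw.emp_mem, h₀⟩, fun n hn => ⟨hw.succ_mem hn.1, h n hn.1 hn.2⟩⟩
  exact ((mem_sep P w n).1 ((hw n).1 hn _ hi)).2

theorem IsOmega.eq_of (hw : IsOmega w) {v : M} (hv : IsOmega v) : v = w :=
  ext fun n => by rw [hw n, hv n]

-- Induction on n: given an injection F of ω into n + 1, the map j ↦ F(j + 1), with the value n
-- replaced by the unused F(0), is an injection of ω into n.
open Classical in
theorem IsOmega.not_dominated (hw : IsOmega w) {n : M} (hn : n ∈ᴹ w) : ¬ Dominated w n := by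
  refine hw.induction (fun n => ¬ Dominated w n) ?_ ?_ hn
  · intro h
    obtain ⟨F, _, hF, -⟩ := h.exists_fun
    exact not_mem_emp _ (hF emp hw.emp_mem)
  · intro n hn hn' h
    obtain ⟨F, _, hF, hF'⟩ := h.exists_fun
    refine hn' (dominated_of (fun j => if F (succ j) = n then F emp else F (succ j)) ?_ ?_)
    · intro z hz
      have h₁ := (mem_succ n _).1 (hF _ (hw.succ_mem hz))
      have h₂ := (mem_succ n _).1 (hF _ hw.emp_mem)
      by_cases h : F (succ z) = n
      · simp only [h, if_true]
        refine h₂.resolve_right fun h' => succ_ne_emp z ?_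
        exact hF' _ _ (hw.succ_mem hz) hw.emp_mem (h.trans h'.symm)
      · simpa only [h, if_false] using h₁.resolve_right h
    · intro y z hy hz h
      have hne : ∀ z, z ∈ᴹ w → F emp ≠ F (succ z) := fun z hz h =>
        succ_ne_emp z (hF' _ _ hw.emp_mem (hw.succ_mem hz) h).symm
      have hs : F (succ y) = F (succ z) → y = z := fun h =>
        succ_inj (hF' _ _ (hw.succ_mem hy) (hw.succ_mem hz) h)
      by_cases h₁ : F (succ y) = n <;> by_cases h₂ : F (succ z) = n <;>
        simp only [h₁, h₂, if_true, if_false] at h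
      · exact hs (h₁.trans h₂.symm)
      · exact (hne z hz h).elim
      · exact (hne y hy h.symm).elim
      · exact hs h

theorem not_isFiniteSet (hw : IsOmega w) {x : M} (h : Dominated w x) : ¬ IsFiniteSet x := by
  rintro ⟨v, n, hv, hn, h'⟩
  rw [hw.eq_of hv] at hn
  exact hw.not_dominated hn (h.trans h'.dominated)

open Classical in
theorem IsOmega.insert_dominated (a b : M) {n : M} (h : Dominated a n) :
    Dominated (union a (sing b)) (succ n) := by
  obtain ⟨F, _, hF, hF'⟩ := h.exists_fun
  refine dominated_of (fun z => if z ∈ᴹ a then F z else n) ?_ ?_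
  · intro z hz
    by_cases h : z ∈ᴹ a
    · simp [h, hF z h]
    · simp [h]
  · intro y z hy hz he
    rw [mem_union, mem_sing] at hy hz
    by_cases h₁ : y ∈ᴹ a <;> by_cases h₂ : z ∈ᴹ a <;> simp only [h₁, h₂, if_true, if_false] at he
    · exact hF' y z h₁ h₂ he
    · exact (mem_irrefl n (by simpa [he] using hF y h₁)).elim
    · exact (mem_irrefl n (by simpa [← he] using hF z h₂)).elim
    · rw [hy.resolve_left h₁, hz.resolve_left h₂]

/-- The product injects into a natural number: rows are added by induction on m, and the pairs of
the new row one at a time by an inner induction. -/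
theorem IsOmega.not_dominated_prod (hw : IsOmega w) {m n : M} (hm : m ∈ᴹ w) (hn : n ∈ᴹ w) :
    ¬ Dominated w (prod m n) := by
  suffices h : ∃ k, k ∈ᴹ w ∧ Dominated (prod m n) k by
    obtain ⟨k, hk, h⟩ := h
    exact fun h' => hw.not_dominated hk (h'.trans h)
  refine hw.induction (fun m => ∃ k, k ∈ᴹ w ∧ Dominated (prod m n) k) ?_ ?_ hm
  · refine ⟨emp, hw.emp_mem, Dominated.of_subset ?_⟩
    simp
  · intro m hm ih
    have key : ∃ k, k ∈ᴹ w ∧ Dominated (union (prod m n) (prod (sing m) n)) k := by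
      refine hw.induction
        (fun n' => ∃ k, k ∈ᴹ w ∧ Dominated (union (prod m n) (prod (sing m) n')) k) ?_ ?_ hn
      · obtain ⟨k, hk, h⟩ := ih
        refine ⟨k, hk, Dominated.trans (.of_subset ?_) h⟩
        simp
      · rintro n' hn' ⟨k, hk, h⟩
        refine ⟨succ k, hw.succ_mem hk, Dominated.trans (.of_subset ?_)
          (IsOmega.insert_dominated _ (pair m n') h)⟩
        simp only [mem_union, mem_prod, mem_sing, mem_succ]
        rintro z (h | ⟨u, hu, y, hy | rfl, rfl⟩)
        · exact Or.inl (Or.inl h)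
        · exact Or.inl (Or.inr ⟨u, hu, y, hy, rfl⟩)
        · exact Or.inr (by rw [hu])
    obtain ⟨k, hk, h⟩ := key
    refine ⟨k, hk, Dominated.trans (.of_subset ?_) h⟩
    simp only [mem_union, mem_prod, mem_sing, mem_succ]
    rintro z ⟨y, hy | hy, h⟩
    · exact Or.inl ⟨y, hy, h⟩
    · exact Or.inr ⟨y, hy, h⟩

open Classical in
/-- A set into which `ω` injects absorbs one more point. -/
theorem sum_sing_dominated (hw : IsOmega w) {x : M} (h : Dominated w x) (c : M) :
    Dominated (sum x (sing c)) x := by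
  obtain ⟨F, _, hF, hF'⟩ := h.exists_fun
  -- Hilbert's hotel: moving F n to F (n + 1) frees F 0 for the new point.
  let G : M → M := fun z => if z ∈ᴹ image w F then F (succ (inv w F z)) else z
  have hG₁ : ∀ n, n ∈ᴹ w → G (F n) = F (succ n) := by
    intro n hn
    have : F n ∈ᴹ image w F := (mem_image F w _).2 ⟨n, hn, rfl⟩
    simp only [G, this, if_true, inv_apply hF' hn]
  have hG₂ : ∀ z, ¬ z ∈ᴹ image w F → G z = z := by
    intro z hz
    simp only [G, hz, if_false]
  have hmem : ∀ z, z ∈ᴹ image w F ↔ ∃ n, n ∈ᴹ w ∧ z = F n := mem_image F w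
  have hGF : ∀ z n, n ∈ᴹ w → G z = F n → ∃ m, m ∈ᴹ w ∧ n = succ m ∧ z = F m := by
    intro z n hn h
    by_cases hz : z ∈ᴹ image w F
    · obtain ⟨m, hm, rfl⟩ := (hmem z).1 hz
      rw [hG₁ m hm] at h
      exact ⟨m, hm, (hF' _ _ (hw.succ_mem hm) hn h).symm, rfl⟩
    · rw [hG₂ z hz] at h
      exact (hz ((hmem z).2 ⟨n, hn, h⟩)).elim
  have : DefFun G := by
    unfold G
    infer_instance
  have : DefFun₁ G := ⟨this⟩
  let H : M → M := fun p => if fst p = emp then G (snd p) else F emp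
  have hl : ∀ z, H (inl z) = G z := by simp [H, inl]
  have hr : ∀ z, H (inr z) = F emp := by simp [H, inr, sing_ne_emp]
  have : DefFun H := by
    unfold H
    infer_instance
  refine dominated_of H ?_ ?_
  · simp only [mem_sum]
    rintro _ (⟨z, hz, rfl⟩ | ⟨z, hz, rfl⟩)
    · rw [hl]
      by_cases h : z ∈ᴹ image w F
      · obtain ⟨m, hm, rfl⟩ := (hmem z).1 h
        rw [hG₁ m hm]
        exact hF _ (hw.succ_mem hm)
      · rwa [hG₂ z h]
    · rw [hr]
      exact hF _ hw.emp_mem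
  · have hne : ∀ z, G z ≠ F emp := by
      intro z h
      obtain ⟨m, hm, h', -⟩ := hGF z emp hw.emp_mem h
      exact succ_ne_emp m h'.symm
    have hinj : ∀ y z, G y = G z → y = z := by
      intro y z h
      by_cases hy : y ∈ᴹ image w F
      · obtain ⟨m, hm, rfl⟩ := (hmem y).1 hy
        rw [hG₁ m hm] at h
        obtain ⟨k, hk, h', rfl⟩ := hGF z _ (hw.succ_mem hm) h.symm
        rw [succ_inj h']
      · by_cases hz : z ∈ᴹ image w F
        · obtain ⟨m, hm, rfl⟩ := (hmem z).1 hz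
          rw [hG₁ m hm] at h
          obtain ⟨k, hk, h', rfl⟩ := hGF y _ (hw.succ_mem hm) h
          rw [succ_inj h']
        · rwa [hG₂ y hy, hG₂ z hz] at h
    simp only [mem_sum, mem_sing]
    rintro _ _ (⟨y, hy, rfl⟩ | ⟨y, rfl, rfl⟩) (⟨z, hz, rfl⟩ | ⟨z, rfl, rfl⟩) h <;>
      simp only [hl, hr] at h
    · rw [hinj y z h]
    · exact (hne y h).elim
    · exact (hne z h.symm).elim
    · rfl

-- The summand is recorded by one bit, the presence of the extra point `inr emp` in a subset of x +
-- 1; and x + 1 ≼ x because ω ≼ x.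
open Classical in
theorem sum_pow_dominated (hw : IsOmega w) {x : M} (h : Dominated w x) :
    Dominated (sum (pow x) (pow x)) (pow x) := by
  refine Dominated.trans ?_ (sum_sing_dominated hw h emp).pow
  let H : M → M := fun p =>
    if fst p = emp then image (snd p) inl else union (image (snd p) inl) (sing (inr emp))
  have hl : ∀ z, H (inl z) = image z inl := by
    intro z
    simp only [H, inl, fst_pair, snd_pair, if_true]
  have hr : ∀ z, H (inr z) = union (image z inl) (sing (inr emp)) := by
    intro z
    simp only [H, inr, fst_pair, snd_pair, sing_ne_emp, if_false]
  have : DefFun H := by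
    unfold H
    infer_instance
  have hl₁ : ∀ z t : M, inl t ∈ᴹ image z inl ↔ t ∈ᴹ z := by simp
  have hl₂ : ∀ z : M, ¬ inr emp ∈ᴹ image z inl := by simp
  have hr₁ : ∀ z t : M, inl t ∈ᴹ union (image z inl) (sing (inr emp)) ↔ t ∈ᴹ z := by simp
  have hr₂ : ∀ z : M, inr emp ∈ᴹ union (image z inl) (sing (inr emp)) := by simp
  refine dominated_of H ?_ ?_
  · intro p hp
    rw [mem_sum] at hp
    simp only [mem_pow_iff] at hp ⊢
    rcases hp with ⟨z, hz, rfl⟩ | ⟨z, hz, rfl⟩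
    · simp only [hl, mem_image]
      rintro _ ⟨y, hy, rfl⟩
      simpa using hz y hy
    · simp only [hr, mem_union, mem_image, mem_sing]
      rintro _ (⟨y, hy, rfl⟩ | rfl)
      · simpa using hz y hy
      · simp
  · simp only [mem_sum]
    rintro _ _ (⟨y, hy, rfl⟩ | ⟨y, hy, rfl⟩) (⟨z, hz, rfl⟩ | ⟨z, hz, rfl⟩) h <;>
      simp only [hl, hr] at h
    · rw [inl_inj]
      exact ext fun t => by rw [← hl₁ y, h, hl₁]
    · exact (hl₂ y (h ▸ hr₂ z)).elim
    · exact (hl₂ z (h ▸ hr₂ y)).elim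
    · rw [inr_inj]
      exact ext fun t => by rw [← hr₁ y, h, hr₁]

end Omega

/-! ### Ordinals, transfinite recursion and Hartogs numbers -/

theorem isOrdinal_of {a : M} (h₁ : ∀ y z, y ∈ᴹ a → z ∈ᴹ y → z ∈ᴹ a)
    (h₂ : ∀ y z, y ∈ᴹ a → z ∈ᴹ a → y ∈ᴹ z ∨ y = z ∨ z ∈ᴹ y) : IsOrdinal a :=
  ⟨fun y hy z hz => h₁ y z hy hz, h₂, fun s _ hs => ModelsZF.foundation s hs⟩

theorem IsOrdinal.mem {a b : M} (h : IsOrdinal a) (hb : b ∈ᴹ a) : IsOrdinal b := by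
  refine isOrdinal_of ?_ ?_
  · intro c d hc hd
    rcases h.2.1 d b (h.mem_trans (h.mem_trans hb hc) hd) hb with h' | rfl | h'
    · exact h'
    · exact (mem_asymm hc hd).elim
    · exact (mem_cycle₃ hd hc h').elim
  · exact fun y z hy hz => h.2.1 y z (h.mem_trans hb hy) (h.mem_trans hb hz)

/-- An ∈-minimal element of b \ a has exactly the elements of a, so it is a. -/
theorem IsOrdinal.mem_of_subset {a b : M} (ha : IsOrdinal a) (hb : IsOrdinal b)
    (h : ∀ z, z ∈ᴹ a → z ∈ᴹ b) (hne : a ≠ b) : a ∈ᴹ b := by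
  have : ∃ y, y ∈ᴹ sep b fun z => ¬ z ∈ᴹ a := by
    by_contra! h'
    refine hne (ext fun z => ⟨h z, fun hz => ?_⟩)
    by_contra hza
    exact h' z ((mem_sep _ _ _).2 ⟨hz, hza⟩)
  obtain ⟨y, hy, hmin⟩ := ModelsZF.foundation _ this
  simp only [mem_sep] at hy hmin
  convert hy.1
  refine ext fun z => ⟨fun hz => ?_, fun hz => ?_⟩
  · rcases hb.2.1 z y (h z hz) hy.1 with h' | rfl | h'
    · exact h'
    · exact (hy.2 hz).elim
    · exact (hy.2 (ha.mem_trans hz h')).elim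
  · by_contra hza
    exact hmin z ⟨hb.mem_trans hy.1 hz, hza⟩ hz

/-- The intersection is an ordinal. If it differed from both a and b, it would belong to both, hence
to itself. -/
theorem IsOrdinal.trichotomy {a b : M} (ha : IsOrdinal a) (hb : IsOrdinal b) :
    a ∈ᴹ b ∨ a = b ∨ b ∈ᴹ a := by
  let c := sep a fun z => z ∈ᴹ b
  have hc : ∀ z, z ∈ᴹ c ↔ z ∈ᴹ a ∧ z ∈ᴹ b := mem_sep _ a
  have hco : IsOrdinal c := by
    refine isOrdinal_of ?_ ?_
    · intro y z hy hz
      rw [hc] at hy ⊢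
      exact ⟨ha.mem_trans hy.1 hz, hb.mem_trans hy.2 hz⟩
    · intro y z hy hz
      exact ha.2.1 y z ((hc y).1 hy).1 ((hc z).1 hz).1
  by_cases h₁ : c = a
  · by_cases h₂ : c = b
    · exact Or.inr (Or.inl (h₁.symm.trans h₂))
    · exact Or.inl (h₁ ▸ hco.mem_of_subset hb (fun z hz => ((hc z).1 hz).2) h₂)
  · have h₁ := hco.mem_of_subset ha (fun z hz => ((hc z).1 hz).1) h₁
    by_cases h₂ : c = b
    · exact Or.inr (Or.inr (h₂ ▸ h₁))
    · have h₂ := hco.mem_of_subset hb (fun z hz => ((hc z).1 hz).2) h₂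
      exact (mem_irrefl c ((hc c).2 ⟨h₁, h₂⟩)).elim

theorem IsOrdinal.subset_of_not_mem {a b : M} (ha : IsOrdinal a) (hb : IsOrdinal b)
    (h : ¬ a ∈ᴹ b) {z : M} (hz : z ∈ᴹ b) : z ∈ᴹ a := by
  rcases ha.trichotomy hb with h' | rfl | h'
  · exact (h h').elim
  · exact hz
  · exact ha.mem_trans h' hz

theorem isOrdinal_of_isOrdinal_mem {a : M} (h₁ : ∀ y z, y ∈ᴹ a → z ∈ᴹ y → z ∈ᴹ a)
    (h₂ : ∀ y, y ∈ᴹ a → IsOrdinal y) : IsOrdinal a :=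
  isOrdinal_of h₁ fun y z hy hz => (h₂ y hy).trichotomy (h₂ z hz)

theorem isOrdinal_emp : IsOrdinal (emp : M) := by
  refine isOrdinal_of ?_ ?_ <;> simp

theorem IsOrdinal.succ {a : M} (ha : IsOrdinal a) : IsOrdinal (succ a) := by
  refine isOrdinal_of_isOrdinal_mem ?_ ?_
  · simp only [mem_succ]
    rintro y z (hy | rfl) hz
    · exact Or.inl (ha.mem_trans hy hz)
    · exact Or.inl hz
  · simp only [mem_succ]
    rintro y (hy | rfl)
    · exact ha.mem hy
    · exact ha

theorem IsOrdinal.exists_least (P : M → Prop) [DefPred P] {a : M} (ha : IsOrdinal a) (h : P a) :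
    ∃ b, IsOrdinal b ∧ P b ∧ ∀ c, c ∈ᴹ b → ¬ P c := by
  obtain ⟨b, hb, hmin⟩ := ModelsZF.foundation (sep (ZFModel.succ a) P)
    ⟨a, (mem_sep _ _ _).2 ⟨by simp, h⟩⟩
  rw [mem_sep] at hb
  refine ⟨b, ha.succ.mem hb.1, hb.2, fun c hc hP => hmin c ?_ hc⟩
  exact (mem_sep _ _ _).2 ⟨ha.succ.mem_trans hb.1 hc, hP⟩

theorem IsOrdinal.induction (P : M → Prop) [DefPred P]
    (h : ∀ a, IsOrdinal a → (∀ b, b ∈ᴹ a → P b) → P a) {a : M} (ha : IsOrdinal a) : P a := by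
  by_contra hP
  obtain ⟨b, hb, hPb, hmin⟩ := ha.exists_least (fun a => ¬ P a) hP
  exact hPb (h b hb fun c hc => not_not.1 (hmin c hc))

theorem IsOmega.isOrdinal {w : M} (hw : IsOmega w) : IsOrdinal w := by
  refine isOrdinal_of_isOrdinal_mem ?_ ?_
  · intro y z hy
    refine hw.induction (fun y => ∀ z, z ∈ᴹ y → z ∈ᴹ w) (by simp) ?_ hy z
    intro n hn ih z hz
    rcases (mem_succ n z).1 hz with h | rfl
    · exact ih z h
    · exact hn
  · intro y hy
    exact hw.induction IsOrdinal isOrdinal_emp (fun _ _ h => h.succ) hy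

/-- The least ordinal satisfying `P`. -/
noncomputable def leastOrd (P : M → Prop) : M :=
  iota fun a => (IsOrdinal a ∧ P a) ∧ ∀ b, b ∈ᴹ a → ¬ P b

instance DefFun.leastOrd {X : Type u} [Context M X] (P : X → M → Prop)
    [hP : DefPred fun p : X × M => P p.1 p.2] : DefFun fun x => leastOrd fun z => P x z := by
  have : DefPred fun p : (X × M) × M => P p.1.1 p.2 :=
    hP.subst (f := fun p : (X × M) × M => (p.1.1, p.2)) inferInstance
  unfold ZFModel.leastOrd
  infer_instance

theorem leastOrd_spec (P : M → Prop) [DefPred P] {a : M} (ha : IsOrdinal a) (h : P a) :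
    IsOrdinal (leastOrd P) ∧ P (leastOrd P) ∧ ∀ b, b ∈ᴹ leastOrd P → ¬ P b := by
  obtain ⟨b, hb, hPb, hmin⟩ := ha.exists_least P h
  have := iota_spec (P := fun a => (IsOrdinal a ∧ P a) ∧ ∀ b, b ∈ᴹ a → ¬ P b)
    ⟨b, ⟨⟨hb, hPb⟩, hmin⟩, by
      rintro c ⟨⟨hc, hPc⟩, hmin'⟩
      rcases hb.trichotomy hc with h | h | h
      · exact (hmin' b h hPb).elim
      · exact h.symm
      · exact (hmin c h hPc).elim⟩
  exact ⟨this.1.1, this.1.2, this.2⟩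

theorem leastOrd_subset (P : M → Prop) [DefPred P] {a : M} (ha : IsOrdinal a) (h : P a) {z : M}
    (hz : z ∈ᴹ leastOrd P) : z ∈ᴹ a := by
  have := leastOrd_spec P ha h
  exact ha.subset_of_not_mem this.1 (fun h' => this.2.2 a h' h) hz

/-- Transfinite recursion on the ordinals. -/
theorem exists_recursion (Ψ : M → M → M) [DefFun₂ Ψ] :
    ∃ P : M → M, DefFun₁ P ∧ ∀ a, IsOrdinal a → P a = Ψ a (lam a P) := by
  -- `Att a g`: g is a set function on a that obeys the recursion throughout a.
  let Att : M → M → Prop := fun a g => g = lam a fun b => Ψ b (lam b fun c => app g c)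
  have hAtt : DefPred₂ Att := ⟨by unfold Att; infer_instance⟩
  let P : M → M := fun a => Ψ a (iota fun g => Att a g)
  have : DefFun P := by
    unfold P
    infer_instance
  have : DefFun₁ P := ⟨this⟩
  refine ⟨P, this, ?_⟩
  have hiota : ∀ a, (∀ g, Att a g ↔ g = lam a P) → (iota fun g => Att a g) = lam a P :=
    fun a h => iota_eq ((h _).2 rfl) fun g hg => (h g).1 hg
  -- Existence and uniqueness of attempts are proved in one induction, by identifying them with the
  -- restriction of P.
  have key : ∀ a, IsOrdinal a → ∀ g, Att a g ↔ g = lam a P := by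
    intro a ha
    refine ha.induction (fun a => ∀ g, Att a g ↔ g = lam a P) ?_
    intro a ha ih g
    constructor
    · intro hg
      have happ : ∀ b, b ∈ᴹ a → app g b = Ψ b (lam b fun c => app g c) := by
        intro b hb
        conv_lhs => rw [show g = _ from hg]
        exact app_lam a (fun b => Ψ b (lam b fun c => app g c)) hb
      rw [show g = _ from hg]
      refine lam_congr a _ _ fun b hb => ?_
      -- An attempt on a restricts to an attempt on each b in a.
      have : Att b (lam b fun c => app g c) := by
        refine lam_congr b _ _ fun c hc => ?_
        rw [happ c (ha.mem_trans hb hc)]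
        congr 1
        refine lam_congr c _ _ fun d hd => ?_
        rw [app_lam b (fun c => app g c) ((ha.mem hb).mem_trans hc hd)]
      rw [(ih b hb _).1 this]
      simp only [P, hiota b (ih b hb)]
    · rintro rfl
      refine lam_congr a _ _ fun b hb => ?_
      simp only [P, hiota b (ih b hb)]
      congr 1
      refine lam_congr b P _ fun c hc => ?_
      rw [app_lam a P (ha.mem_trans hb hc)]
  intro a ha
  simp only [P, hiota a (key a ha)]

/-- `s` is the image in `x` of the order of the ordinal `a` under an injection of `a` into `x`. -/
def IsOrderCode (x a s : M) : Prop :=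
  ∃ f, IsInjection f a x ∧ ∀ p, p ∈ᴹ s ↔ ∃ y z, y ∈ᴹ a ∧ z ∈ᴹ a ∧ IsSubset y z ∧
    p = pair (app f y) (app f z)

instance (x : M) : DefPred₂ (IsOrderCode x) := by
  constructor
  simp only [IsOrderCode, isInjection_iff, isFunction_iff]
  infer_instance

/-- The two injections have the same range and induce the same order on it. So they differ by an
isomorphism of ordinals, which ∈-induction shows to be the identity. -/
theorem IsOrderCode.unique {x a b s : M} (ha : IsOrdinal a) (hb : IsOrdinal b)
    (h₁ : IsOrderCode x a s) (h₂ : IsOrderCode x b s) : a = b := by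
  have sub : ∀ {a b : M}, IsOrdinal b → ∀ {f g}, IsInjection f a x → IsInjection g b x →
      (∀ p, p ∈ᴹ s ↔ ∃ y z, y ∈ᴹ a ∧ z ∈ᴹ a ∧ IsSubset y z ∧ p = pair (app f y) (app f z)) →
      (∀ p, p ∈ᴹ s ↔ ∃ y z, y ∈ᴹ b ∧ z ∈ᴹ b ∧ IsSubset y z ∧ p = pair (app g y) (app g z)) →
      IsOrdinal a →
      (∀ y, y ∈ᴹ a → ∃ y', y' ∈ᴹ b ∧ app f y = app g y') ∧
      ∀ y z y' z', y ∈ᴹ a → z ∈ᴹ a → y' ∈ᴹ b → z' ∈ᴹ b → app f y = app g y' →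
        app f z = app g z' → y ∈ᴹ z → y' ∈ᴹ z' := by
    intro a b hb f g hf hg hs hs' ha
    constructor
    -- Codes are reflexive relations, so the diagonal pair at y puts f y in the range of g. With
    -- strict orders, 0 and 1 would share the empty code.
    · intro y hy
      obtain ⟨y', z', hy', -, -, h⟩ :=
        (hs' _).1 ((hs _).2 ⟨y, y, hy, hy, fun _ h => h, rfl⟩)
      exact ⟨y', hy', (pair_inj.1 h).1⟩
    · intro y z y' z' hy hz hy' hz' hyy hzz hyz
      obtain ⟨u, v, hu, hv, huv, h⟩ :=
        (hs' _).1 ((hs _).2 ⟨y, z, hy, hz, fun _ h => (ha.mem hz).mem_trans hyz h, rfl⟩)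
      rw [pair_inj, hyy, hzz] at h
      have h₁ := app_injOn hg hy' hu h.1
      have h₂ := app_injOn hg hz' hv h.2
      subst h₁ h₂
      refine (hb.mem hy').mem_of_subset (hb.mem hz') huv ?_
      rintro rfl
      have := app_injOn hf hy hz (hyy.trans hzz.symm)
      subst this
      exact mem_irrefl _ hyz
  obtain ⟨f, hf, hs⟩ := h₁
  obtain ⟨g, hg, hs'⟩ := h₂
  obtain ⟨hex, hlt⟩ := sub hb hf hg hs hs' ha
  obtain ⟨hex', hlt'⟩ := sub ha hg hf hs' hs hb
  have key : ∀ y, y ∈ᴹ a → ∀ y', y' ∈ᴹ b → app f y = app g y' → y = y' := by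
    intro y hy
    refine (ha.mem hy).induction
      (fun y => y ∈ᴹ a → ∀ y', y' ∈ᴹ b → app f y = app g y' → y = y') ?_ hy
    intro y _ ih hy y' hy' h
    refine ext fun z => ⟨fun hz => ?_, fun hz => ?_⟩
    · have hza := ha.mem_trans hy hz
      obtain ⟨z', hz', hzz⟩ := hex z hza
      rw [ih z hz hza z' hz' hzz]
      exact hlt z y z' y' hza hy hz' hy' hzz h hz
    · have hzb := hb.mem_trans hy' hz
      obtain ⟨z', hz', hzz⟩ := hex' z hzb
      have := hlt' z y' z' y hzb hy' hz' hy hzz h.symm hz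
      rwa [← ih z' this hz' z hzb hzz.symm]
  refine ext fun z => ⟨fun hz => ?_, fun hz => ?_⟩
  · obtain ⟨z', hz', h⟩ := hex z hz
    rwa [key z hz z' hz' h]
  · obtain ⟨z', hz', h⟩ := hex' z hz
    rwa [← key z' hz' z hz h.symm]

theorem exists_isOrderCode {x a : M} (h : Dominated a x) :
    ∃ s, s ∈ᴹ pow (prod x x) ∧ IsOrderCode x a s := by
  obtain ⟨f, hf⟩ := h
  let Q : M → Prop := fun p => ∃ y z, y ∈ᴹ a ∧ z ∈ᴹ a ∧ IsSubset y z ∧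
    p = pair (app f y) (app f z)
  have : DefPred Q := by
    unfold Q
    infer_instance
  refine ⟨sep (prod x x) Q, ?_, f, hf, fun p => ?_⟩
  · rw [mem_pow_iff]
    exact fun w hw => ((mem_sep Q _ w).1 hw).1
  · rw [mem_sep]
    refine ⟨fun h => h.2, fun h => ⟨?_, h⟩⟩
    obtain ⟨y, z, hy, hz, -, rfl⟩ := h
    exact (mem_prod _ _ _).2 ⟨_, app_mem hf.1 hy, _, app_mem hf.1 hz, rfl⟩

/-- The Hartogs number exists and injects into `𝒫 𝒫 (x × x)`. -/
theorem exists_hartogs (x : M) : ∃ h, IsHartogs h x ∧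
    (∀ a, a ∈ᴹ h ↔ IsOrdinal a ∧ Dominated a x) ∧ Dominated h (pow (pow (prod x x))) := by
  -- Replacement sends each code to its ordinal. A relation that codes nothing goes to the default
  -- of `iota`, which the separation keeps only if it qualifies anyway.
  let h : M := sep (image (pow (prod x x)) fun s => iota fun a => IsOrdinal a ∧ IsOrderCode x a s)
    fun a => IsOrdinal a ∧ Dominated a x
  have hh : ∀ a, a ∈ᴹ h ↔ IsOrdinal a ∧ Dominated a x := by
    intro a
    rw [mem_sep]
    refine ⟨fun h => h.2, fun h => ⟨?_, h⟩⟩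
    obtain ⟨s, hs, hc⟩ := exists_isOrderCode h.2
    rw [mem_image]
    exact ⟨s, hs, (iota_eq ⟨h.1, hc⟩ fun b hb => hb.2.unique hb.1 h.1 hc).symm⟩
  have ho : IsOrdinal h := by
    refine isOrdinal_of_isOrdinal_mem ?_ fun y hy => ((hh y).1 hy).1
    intro y z hy hz
    rw [hh] at hy ⊢
    exact ⟨hy.1.mem hz, Dominated.trans (.of_subset fun _ h => hy.1.mem_trans hz h) hy.2⟩
  refine ⟨h, ⟨ho, fun hd => mem_irrefl h ((hh h).2 ⟨ho, hd⟩), fun b hb hbd z hz => ?_⟩, hh, ?_⟩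
  · exact hb.subset_of_not_mem ho (fun hbh => hbd ((hh b).1 hbh).2) hz
  -- Choosing one code per ordinal would need choice; the set of all its codes does not. These sets
  -- are nonempty and pairwise disjoint.
  · refine dominated_of (fun a => sep (pow (prod x x)) fun s => IsOrderCode x a s) ?_ ?_
    · intro a _
      rw [mem_pow_iff]
      exact fun s hs => ((mem_sep _ _ _).1 hs).1
    · intro a b ha hb hab
      rw [hh] at ha hb
      obtain ⟨s, hs, hc⟩ := exists_isOrderCode ha.2
      have : s ∈ᴹ sep (pow (prod x x)) fun s => IsOrderCode x b s := by
        rw [← hab, mem_sep]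
        exact ⟨hs, hc⟩
      rw [mem_sep] at this
      exact hc.unique ha.1 hb.1 this.2

end

/-! ### Recursions exhausting a set: well-orderings from injections into ordinals -/

section

variable {M : Type u} [setLang.Structure M] [ModelsZF M]

theorem IsOrdinal.injOn_of_ne {c : M} (hc : IsOrdinal c) {P : M → M}
    (h : ∀ a, a ∈ᴹ c → ∀ b, b ∈ᴹ a → P a ≠ P b) {y z : M} (hy : y ∈ᴹ c) (hz : z ∈ᴹ c)
    (hyz : P y = P z) : y = z := by
  rcases (hc.mem hy).trichotomy (hc.mem hz) with h' | h' | h'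
  · exact (h z hz y h' hyz.symm).elim
  · exact h'
  · exact (h y hy z h' hyz).elim

/-- The ordinals do not inject into a set. -/
theorem not_forall_ordinal_injective (x : M) (P : M → M) [DefFun P] :
    ¬ ∀ a, IsOrdinal a → P a ∈ᴹ x ∧ ∀ b, b ∈ᴹ a → P a ≠ P b := by
  intro h
  obtain ⟨c, hc, -⟩ := exists_hartogs x
  exact hc.2.1 (dominated_of P (fun z hz => (h z (hc.1.mem hz)).1) fun y z hy hz =>
    hc.1.injOn_of_ne (fun a ha => (h a (hc.1.mem ha)).2) hy hz)

/-- A set which injects into an ordinal is well-orderable. -/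
theorem isWellOrderable_of_dominated {x h : M} (ho : IsOrdinal h) (hd : Dominated x h) :
    IsWellOrderable x := by
  obtain ⟨K, _, hK, hK'⟩ := hd.exists_fun
  -- The next element is the unlisted z with least K z. The value is irrelevant once x is exhausted.
  let Ψ : M → M → M := fun a g =>
    inv x K (leastOrd fun k => ∃ z, z ∈ᴹ x ∧ K z = k ∧ ∀ b, b ∈ᴹ a → app g b ≠ z)
  have : DefFun₂ Ψ := ⟨by unfold Ψ; infer_instance⟩
  obtain ⟨P, _, hP⟩ := exists_recursion Ψ
  have step : ∀ a, IsOrdinal a → (∃ z, z ∈ᴹ x ∧ ∀ b, b ∈ᴹ a → P b ≠ z) →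
      P a ∈ᴹ x ∧ ∀ b, b ∈ᴹ a → P a ≠ P b := by
    rintro a ha ⟨z, hz, hza⟩
    obtain ⟨-, ⟨y, hy, hyk, hya⟩, -⟩ := leastOrd_spec
      (fun k => ∃ z, z ∈ᴹ x ∧ K z = k ∧ ∀ b, b ∈ᴹ a → app (lam a P) b ≠ z) (ho.mem (hK z hz))
      ⟨z, hz, rfl, fun b hb => by rw [app_lam a P hb]; exact hza b hb⟩
    have hPa : P a = y := by
      rw [hP a ha]
      simp only [Ψ]
      rw [← hyk, inv_apply hK' hy]
    rw [hPa]
    refine ⟨hy, fun b hb h => hya b hb ?_⟩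
    rw [app_lam a P hb, h]
  have hex : ∃ a, IsOrdinal a ∧ ∀ z, z ∈ᴹ x → ∃ b, b ∈ᴹ a ∧ P b = z := by
    by_contra! hne
    exact not_forall_ordinal_injective x P fun a ha => step a ha (hne a ha)
  obtain ⟨a, ha, hPa⟩ := hex
  -- At the first stage c that exhausts x, every earlier step produced a new element, so P is a
  -- bijection from c to x.
  obtain ⟨c, hc, hPc, hmin⟩ := ha.exists_least (fun a => ∀ z, z ∈ᴹ x → ∃ b, b ∈ᴹ a ∧ P b = z) hPa
  have hstep : ∀ b, b ∈ᴹ c → P b ∈ᴹ x ∧ ∀ d, d ∈ᴹ b → P b ≠ P d := by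
    intro b hb
    refine step b (hc.mem hb) ?_
    have := hmin b hb
    push Not at this
    exact this
  have he : Equinumerous c x := equinumerous_of P (fun z hz => (hstep z hz).1)
    (fun y z hy hz => hc.injOn_of_ne (fun b hb => (hstep b hb).2) hy hz) hPc
  exact ⟨c, hc, .of_dominated he.dominated_symm he.dominated⟩

/-! ### Choice-free pairing on infinite ordinals -/

/-- A pair of ordinals outside `u`, chosen with the least maximum. -/
noncomputable def leastPair (u : M) : M :=
  (fun d => (fun b => pair b (leastOrd fun c => c ∈ᴹ succ d ∧ ¬ pair b c ∈ᴹ u))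
    (leastOrd fun b => b ∈ᴹ succ d ∧ ∃ c, c ∈ᴹ succ d ∧ ¬ pair b c ∈ᴹ u))
  (leastOrd fun d => ∃ b c, b ∈ᴹ succ d ∧ c ∈ᴹ succ d ∧ ¬ pair b c ∈ᴹ u)

instance : DefFun₁ (leastPair (M := M)) := ⟨by unfold leastPair; infer_instance⟩

/-- Since the maximum is minimized first, the chosen pair stays in the square of d + 1 for every d
whose square still has a free pair. -/
theorem leastPair_spec {u d b c : M} (hd : IsOrdinal d) (hb : b ∈ᴹ succ d) (hc : c ∈ᴹ succ d)
    (h : ¬ pair b c ∈ᴹ u) : ∃ b' c', b' ∈ᴹ succ d ∧ c' ∈ᴹ succ d ∧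
      leastPair u = pair b' c' ∧ ¬ pair b' c' ∈ᴹ u := by
  have hPd : ∃ b c, b ∈ᴹ succ d ∧ c ∈ᴹ succ d ∧ ¬ pair b c ∈ᴹ u := ⟨b, c, hb, hc, h⟩
  have hsub := fun z => leastOrd_subset
    (fun d => ∃ b c, b ∈ᴹ succ d ∧ c ∈ᴹ succ d ∧ ¬ pair b c ∈ᴹ u) hd hPd (z := z)
  obtain ⟨ho, ⟨b₁, c₁, hb₁, hc₁, h₁⟩, -⟩ := leastOrd_spec
    (fun d => ∃ b c, b ∈ᴹ succ d ∧ c ∈ᴹ succ d ∧ ¬ pair b c ∈ᴹ u) hd hPd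
  simp only [leastPair]
  set e := leastOrd fun d : M => ∃ b c, b ∈ᴹ succ d ∧ c ∈ᴹ succ d ∧ ¬ pair b c ∈ᴹ u
  obtain ⟨-, ⟨hb₂, c₂, hc₂, h₂⟩, -⟩ := leastOrd_spec
    (fun b => b ∈ᴹ succ e ∧ ∃ c, c ∈ᴹ succ e ∧ ¬ pair b c ∈ᴹ u) (ho.succ.mem hb₁)
    ⟨hb₁, c₁, hc₁, h₁⟩
  set b' := leastOrd fun b => b ∈ᴹ succ e ∧ ∃ c, c ∈ᴹ succ e ∧ ¬ pair b c ∈ᴹ u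
  obtain ⟨-, ⟨hc₃, h₃⟩, -⟩ := leastOrd_spec
    (fun c => c ∈ᴹ succ e ∧ ¬ pair b' c ∈ᴹ u) (ho.succ.mem hc₂) ⟨hc₂, h₂⟩
  have hsucc : ∀ z, z ∈ᴹ succ e → z ∈ᴹ succ d := by
    intro z hz
    have hed : e ∈ᴹ succ d := by
      rw [mem_succ]
      by_cases hed : e = d
      · exact Or.inr hed
      · exact Or.inl (ho.mem_of_subset hd hsub hed)
    rcases (mem_succ e z).1 hz with hz | rfl
    · exact hd.succ.mem_trans hed hz
    · exact hed
  exact ⟨b', _, hsucc _ hb₂, hsucc _ hc₃, rfl, h₃⟩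

/-- There is a definable sequence of distinct pairs of ordinals with increasing maxima. -/
theorem exists_enum_pairs : ∃ E : M → M, DefFun₁ E ∧ ∀ a d b c, IsOrdinal a → IsOrdinal d →
    b ∈ᴹ succ d → c ∈ᴹ succ d → (∀ i, i ∈ᴹ a → E i ≠ pair b c) →
    E a ∈ᴹ prod (succ d) (succ d) ∧ ∀ i, i ∈ᴹ a → E a ≠ E i := by
  have : DefFun₂ fun a g : M => leastPair (image a fun i => app g i) := ⟨inferInstance⟩
  obtain ⟨E, _, hE⟩ := exists_recursion fun a g : M => leastPair (image a fun i => app g i)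
  refine ⟨E, inferInstance, fun a d b c ha hd hb hc h => ?_⟩
  have hmem : ∀ z, z ∈ᴹ image a (fun i => app (lam a E) i) ↔ ∃ i, i ∈ᴹ a ∧ z = E i := by
    intro z
    rw [mem_image]
    refine exists_congr fun i => and_congr_right fun hi => ?_
    rw [app_lam a E hi]
  obtain ⟨b', c', hb', hc', he, hn⟩ := leastPair_spec
    (u := image a fun i => app (lam a E) i) hd hb hc fun h' => by
      obtain ⟨i, hi, h'⟩ := (hmem _).1 h'
      exact h i hi h'.symm
  rw [← hE a ha] at he
  rw [hmem] at hn
  push Not at hn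
  rw [he]
  exact ⟨(mem_prod _ _ _).2 ⟨b', hb', c', hc', rfl⟩, hn⟩

open Classical in
/-- An injection of `succ d` into `d` for infinite ordinals `d`. -/
noncomputable def shift (w d z : M) : M :=
  if z = d then emp else if z ∈ᴹ w then succ z else z

instance (w : M) : DefFun₂ (shift w) := ⟨by unfold shift; infer_instance⟩

theorem shift_mem {w d z : M} (hw : IsOmega w) (h : ∀ n, n ∈ᴹ w → n ∈ᴹ d)
    (hz : z ∈ᴹ succ d) : shift w d z ∈ᴹ d := by
  unfold shift
  split_ifs with h₁ h₂
  · exact h _ hw.emp_mem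
  · exact h _ (hw.succ_mem h₂)
  · exact ((mem_succ d z).1 hz).resolve_right h₁

theorem shift_inj {w d y z : M} (hw : IsOmega w) (h : shift w d y = shift w d z) : y = z := by
  unfold shift at h
  split_ifs at h with h₁ h₂ h₃ h₄ h₅ h₆ h₇
  · rw [h₁, h₂]
  · exact (succ_ne_emp z h.symm).elim
  · exact (h₃ (h ▸ hw.emp_mem)).elim
  · exact (succ_ne_emp y h).elim
  · exact succ_inj h
  · exact (h₆ (h ▸ hw.succ_mem h₄)).elim
  · exact (h₄ (h ▸ hw.emp_mem)).elim
  · exact (h₄ (h ▸ hw.succ_mem (by assumption))).elim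
  · exact h

open Classical in
/-- There are definable injections `a × a → a`, uniformly in the infinite ordinal `a`. -/
theorem exists_pairing {w : M} (hw : IsOmega w) : ∃ p : M → M → M, DefFun₂ p ∧
    ∀ a, IsOrdinal a → (∀ n, n ∈ᴹ w → n ∈ᴹ a) → (∀ q, q ∈ᴹ prod a a → p a q ∈ᴹ a) ∧
      ∀ q r, q ∈ᴹ prod a a → r ∈ᴹ prod a a → p a q = p a r → q = r := by
  obtain ⟨E, _, hE⟩ := exists_enum_pairs (M := M)
  -- Used when E[a] does not cover a × a: E then maps a into the square of d + 1 for some d < a, and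
  -- `B a` is the least such d.
  let B : M → M := fun a => leastOrd fun d =>
    d ∈ᴹ a ∧ ∀ i, i ∈ᴹ a → E i ∈ᴹ prod (succ d) (succ d)
  have : DefFun₁ B := ⟨by unfold B; infer_instance⟩
  -- With d = `B a` this embeds a into d × d.
  let S : M → M → M := fun d i => pair (shift w d (fst (E i))) (shift w d (snd (E i)))
  have : DefFun₂ S := ⟨by unfold S; infer_instance⟩
  -- If E[a] covers a × a, invert E. Otherwise use the pairing of d = `B a` three times: a × a → (d
  -- × d) × (d × d) → d × d → d.
  let Ψ : M → M → M := fun a g =>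
    if ∀ q, q ∈ᴹ prod a a → ∃ i, i ∈ᴹ a ∧ E i = q then
      lam (prod a a) fun q => leastOrd fun i => E i = q
    else lam (prod a a) fun q => app (app g (B a))
      (pair (app (app g (B a)) (S (B a) (fst q))) (app (app g (B a)) (S (B a) (snd q))))
  have : DefFun₂ Ψ := ⟨by unfold Ψ; infer_instance⟩
  obtain ⟨P, _, hP⟩ := exists_recursion Ψ
  refine ⟨fun a q => app (P a) q, ⟨inferInstance⟩, fun a ha => ha.induction
    (fun a => (∀ n, n ∈ᴹ w → n ∈ᴹ a) → (∀ q, q ∈ᴹ prod a a → app (P a) q ∈ᴹ a) ∧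
      ∀ q r, q ∈ᴹ prod a a → r ∈ᴹ prod a a → app (P a) q = app (P a) r → q = r) ?_⟩
  intro a ha ih hwa
  by_cases hcl : ∀ q, q ∈ᴹ prod a a → ∃ i, i ∈ᴹ a ∧ E i = q
  · have hP' : ∀ q, q ∈ᴹ prod a a → app (P a) q ∈ᴹ a ∧ E (app (P a) q) = q := by
      intro q hq
      rw [hP a ha]
      simp only [Ψ]
      rw [if_pos hcl, app_lam _ (fun q => leastOrd fun i => E i = q) hq]
      obtain ⟨i, hi, hiq⟩ := hcl q hq
      obtain ⟨ho, he, hmin⟩ := leastOrd_spec (fun i => E i = q) (ha.mem hi) hiq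
      refine ⟨?_, he⟩
      by_contra hn
      exact hmin i (ho.subset_of_not_mem ha hn hi) hiq
    exact ⟨fun q hq => (hP' q hq).1, fun q r hq hr h => by
      rw [← (hP' q hq).2, h, (hP' r hr).2]⟩
  -- Take d to be the maximum of an unlisted pair in a × a: as this pair stays free below a, each E
  -- i is new and lies in the square of d + 1.
  · have hbound : ∃ d, d ∈ᴹ a ∧ (∀ i, i ∈ᴹ a → E i ∈ᴹ prod (succ d) (succ d)) ∧
        ∀ i, i ∈ᴹ a → ∀ j, j ∈ᴹ i → E i ≠ E j := by
      push Not at hcl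
      obtain ⟨q, hq, hqE⟩ := hcl
      obtain ⟨b, hb, c, hc, rfl⟩ := (mem_prod _ _ _).1 hq
      obtain ⟨d, hd, hbd, hcd⟩ : ∃ d, d ∈ᴹ a ∧ b ∈ᴹ succ d ∧ c ∈ᴹ succ d := by
        simp only [mem_succ]
        rcases ha.2.1 b c hb hc with h | h | h
        · exact ⟨c, hc, Or.inl h, Or.inr rfl⟩
        · exact ⟨c, hc, Or.inr h, Or.inr rfl⟩
        · exact ⟨b, hb, Or.inr rfl, Or.inl h⟩
      have := fun i hi => hE i d b c (ha.mem hi) (ha.mem hd) hbd hcd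
        fun j hj => hqE j (ha.mem_trans hi hj)
      exact ⟨d, hd, fun i hi => (this i hi).1, fun i hi => (this i hi).2⟩
    obtain ⟨d₀, hd₀, hEd₀, hEne⟩ := hbound
    have hEinj : ∀ i j, i ∈ᴹ a → j ∈ᴹ a → E i = E j → i = j :=
      fun i j hi hj => ha.injOn_of_ne hEne hi hj
    obtain ⟨-, ⟨hda, hEd⟩, -⟩ := leastOrd_spec
      (fun d => d ∈ᴹ a ∧ ∀ i, i ∈ᴹ a → E i ∈ᴹ prod (succ d) (succ d)) (ha.mem hd₀) ⟨hd₀, hEd₀⟩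
    change B a ∈ᴹ a at hda
    change ∀ i, i ∈ᴹ a → E i ∈ᴹ prod (succ (B a)) (succ (B a)) at hEd
    have hP' : ∀ q, q ∈ᴹ prod a a → app (P a) q = app (P (B a))
        (pair (app (P (B a)) (S (B a) (fst q))) (app (P (B a)) (S (B a) (snd q)))) := by
      intro q hq
      rw [hP a ha]
      simp only [Ψ]
      rw [if_neg hcl, app_lam _ _ hq, app_lam a P hda]
    generalize B a = d at *
    have hwd : ∀ n, n ∈ᴹ w → n ∈ᴹ d := by
      -- The induction hypothesis needs d infinite; otherwise E would inject ω into the finite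
      -- square of d + 1.
      have hdw : ¬ d ∈ᴹ w := fun hdw =>
        hw.not_dominated_prod (hw.succ_mem hdw) (hw.succ_mem hdw)
          (dominated_of E (fun n hn => hEd n (hwa n hn))
            fun y z hy hz => hEinj y z (hwa y hy) (hwa z hz))
      exact fun n hn => (ha.mem hda).subset_of_not_mem hw.isOrdinal hdw hn
    obtain ⟨hpd, hpd'⟩ := ih d hda hwd
    have hS : ∀ i, i ∈ᴹ a → S d i ∈ᴹ prod d d := by
      intro i hi
      obtain ⟨b, hb, c, hc, h⟩ := (mem_prod _ _ _).1 (hEd i hi)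
      refine (mem_prod _ _ _).2 ⟨_, shift_mem hw hwd hb, _, shift_mem hw hwd hc, ?_⟩
      simp only [S, h, fst_pair, snd_pair]
    have hS' : ∀ i j, i ∈ᴹ a → j ∈ᴹ a → S d i = S d j → i = j := by
      intro i j hi hj h
      refine hEinj i j hi hj ?_
      obtain ⟨b, hb, c, hc, h₁⟩ := (mem_prod _ _ _).1 (hEd i hi)
      obtain ⟨b', hb', c', hc', h₂⟩ := (mem_prod _ _ _).1 (hEd j hj)
      simp only [S, h₁, h₂, fst_pair, snd_pair, pair_inj] at h
      rw [h₁, h₂, shift_inj hw h.1, shift_inj hw h.2]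
    have hpair : ∀ i j, i ∈ᴹ a → j ∈ᴹ a →
        pair (app (P d) (S d i)) (app (P d) (S d j)) ∈ᴹ prod d d := fun i j hi hj =>
      (mem_prod _ _ _).2 ⟨_, hpd _ (hS i hi), _, hpd _ (hS j hj), rfl⟩
    constructor
    · intro q hq
      rw [hP' q hq]
      obtain ⟨i, hi, j, hj, rfl⟩ := (mem_prod _ _ _).1 hq
      rw [fst_pair, snd_pair]
      exact ha.mem_trans hda (hpd _ (hpair i j hi hj))
    · intro q r hq hr h
      rw [hP' q hq, hP' r hr] at h
      obtain ⟨i, hi, j, hj, rfl⟩ := (mem_prod _ _ _).1 hq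
      obtain ⟨k, hk, l, hl, rfl⟩ := (mem_prod _ _ _).1 hr
      simp only [fst_pair, snd_pair] at h
      have h := pair_inj.1 (hpd' _ _ (hpair i j hi hj) (hpair k l hk hl) h)
      rw [hS' i k hi hk (hpd' _ _ (hS i hi) (hS k hk) h.1),
        hS' j l hj hl (hpd' _ _ (hS j hj) (hS l hl) h.2)]

/-! ### The power set of an infinite set against its square -/

open Classical in
/-- The power set of an infinite set does not inject into its square. -/
theorem not_pow_dominated_prod {w x : M} (hw : IsOmega w) (hx : Dominated w x) :
    ¬ Dominated (pow x) (prod x x) := by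
  intro hd
  obtain ⟨F, _, hF, hF'⟩ := hd.exists_fun
  obtain ⟨G, _, hG, hG'⟩ := hx.exists_fun
  obtain ⟨p, _, hp⟩ := exists_pairing hw
  -- Given the list g of length a, the index i = p a (b, c) codes the pair (g b, g c). The diagonal
  -- set D contains g i unless this pair is F s for some subset s that contains g i.
  let D : M → M → M := fun a g => sep x fun z => ∃ i, i ∈ᴹ a ∧ z = app g i ∧
    ∀ q, q ∈ᴹ prod a a → p a q = i → ∀ s, s ∈ᴹ pow x →
      F s = pair (app g (fst q)) (app g (snd q)) → ¬ z ∈ᴹ s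
  have hDdef : ∀ a g, D a g = sep x fun z => ∃ i, i ∈ᴹ a ∧ z = app g i ∧
    ∀ q, q ∈ᴹ prod a a → p a q = i → ∀ s, s ∈ᴹ pow x →
      F s = pair (app g (fst q)) (app g (snd q)) → ¬ z ∈ᴹ s := fun _ _ => rfl
  have : DefFun₂ D := ⟨by unfold D; infer_instance⟩
  clear_value D
  -- The list starts with the copy of ω so that infinite stages have a pairing. Later, some
  -- coordinate of F D is new: take the first unless it is already listed, otherwise the second.
  let Ψ : M → M → M := fun a g => if a ∈ᴹ w then G a else
    if ∃ i, i ∈ᴹ a ∧ app g i = fst (F (D a g)) then snd (F (D a g)) else fst (F (D a g))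
  have : DefFun₂ Ψ := ⟨by unfold Ψ; infer_instance⟩
  obtain ⟨P, _, hP⟩ := exists_recursion Ψ
  refine not_forall_ordinal_injective x P fun a ha => ha.induction
    (fun a => P a ∈ᴹ x ∧ ∀ b, b ∈ᴹ a → P a ≠ P b) fun a ha ih => ?_
  have hPw : ∀ n, n ∈ᴹ w → P n = G n := by
    intro n hn
    rw [hP n (hw.isOrdinal.mem hn)]
    simp only [Ψ]
    rw [if_pos hn]
  by_cases haw : a ∈ᴹ w
  · rw [hPw a haw]
    refine ⟨hG a haw, fun b hb h => ?_⟩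
    have hbw := hw.isOrdinal.mem_trans haw hb
    rw [hPw b hbw] at h
    rw [hG' a b haw hbw h] at hb
    exact mem_irrefl b hb
  · have hPinj : ∀ i j, i ∈ᴹ a → j ∈ᴹ a → P i = P j → i = j :=
      fun i j hi hj => ha.injOn_of_ne (fun b hb => (ih b hb).2) hi hj
    obtain ⟨hpa, hpa'⟩ := hp a ha fun n hn => ha.subset_of_not_mem hw.isOrdinal haw hn
    have happ : ∀ i, i ∈ᴹ a → app (lam a P) i = P i := fun i hi => app_lam a P hi
    have hPa := hP a ha
    simp only [Ψ] at hPa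
    rw [if_neg haw] at hPa
    have hDx : D a (lam a P) ∈ᴹ pow x := by
      rw [mem_pow_iff, hDdef]
      exact fun z hz => ((mem_sep _ _ _).1 hz).1
    have hD : ∀ z, z ∈ᴹ D a (lam a P) ↔ z ∈ᴹ x ∧ ∃ i, i ∈ᴹ a ∧ z = app (lam a P) i ∧
        ∀ q, q ∈ᴹ prod a a → p a q = i → ∀ s, s ∈ᴹ pow x →
          F s = pair (app (lam a P) (fst q)) (app (lam a P) (snd q)) → ¬ z ∈ᴹ s := by
      intro z
      rw [hDdef]
      exact mem_sep _ _ _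
    generalize D a (lam a P) = d at *
    obtain ⟨u, hu, v, hv, hFd⟩ := (mem_prod _ _ _).1 (hF d hDx)
    rw [hFd, fst_pair, snd_pair] at hPa
    -- Were both coordinates listed, as P b and P c, then for i = p a (b, c) injectivity of F, P and
    -- p would give P i ∈ D exactly when P i ∉ D.
    have key : ∀ b c, b ∈ᴹ a → c ∈ᴹ a → u = P b → v ≠ P c := by
      rintro b c hb hc rfl rfl
      have hbc : pair b c ∈ᴹ prod a a := (mem_prod _ _ _).2 ⟨b, hb, c, hc, rfl⟩
      set i := p a (pair b c) with hi
      have hia : i ∈ᴹ a := hpa _ hbc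
      have hnot : ¬ P i ∈ᴹ d := by
        intro h
        obtain ⟨-, j, hj, hij, hall⟩ := (hD _).1 h
        rw [happ j hj] at hij
        have hji := hPinj i j hia hj hij
        refine hall (pair b c) hbc (hi.symm.trans hji) d hDx ?_ h
        rw [fst_pair, snd_pair, happ b hb, happ c hc, hFd]
      refine hnot ((hD _).2 ⟨(ih i hia).1, i, hia, (happ i hia).symm, ?_⟩)
      intro q hq hqi s hs hFs
      rw [hpa' q _ hq hbc hqi, fst_pair, snd_pair, happ b hb, happ c hc, ← hFd] at hFs
      rwa [hF' s d hs hDx hFs]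
    by_cases h : ∃ i, i ∈ᴹ a ∧ app (lam a P) i = u
    · rw [if_pos h] at hPa
      rw [hPa]
      obtain ⟨i, hi, hiu⟩ := h
      rw [happ i hi] at hiu
      exact ⟨hv, fun b hb => key i b hi hb hiu.symm⟩
    · rw [if_neg h] at hPa
      rw [hPa]
      refine ⟨hu, fun b hb hub => h ⟨b, hb, ?_⟩⟩
      rw [happ b hb, hub]

/-- The dichotomy through which both GCH hypotheses enter, phrased with injections only. -/
theorem IsGCHSet.dominated_or {x y : M} (h : IsGCHSet x) (hf : ¬ IsFiniteSet x)
    (h₁ : Dominated x y) (h₂ : Dominated y (pow x)) : Dominated y x ∨ Dominated (pow x) y := by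
  by_contra! hn
  exact h.resolve_left hf y ⟨⟨h₁, fun he => hn.1 he.dominated_symm⟩,
    ⟨h₂, fun he => hn.2 he.dominated_symm⟩⟩

end

end ZFModel

/-! ### Specker's theorem -/

open ZFModel in
theorem theorem1 {M : Type*} [setLang.Structure M] [ModelsZF M] (x : M)
    (hinf : OmegaDominated x) (hx : IsGCHSet x) (hpow : IsGCHSet (pow x)) :
    (∃ h, IsHartogs h x ∧ Equinumerous h (pow x)) ∧
      IsWellOrderable (pow x) ∧ IsWellOrderable x := by
  obtain ⟨w, hw, hwx⟩ := hinf
  have hxp := dominated_pow x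
  have hwp : Dominated w (pow x) := hwx.trans hxp
  have hfx := not_isFiniteSet hw hwx
  have hfp := not_isFiniteSet hw hwp
  have hpp := sum_pow_dominated hw hwx
  have hsum_prod : Dominated (sum x x) (prod x x) := by
    obtain ⟨F, _, hF, hF'⟩ := hwx.exists_fun
    refine sum_self_dominated_prod (hF _ hw.emp_mem) (hF _ (hw.succ_mem hw.emp_mem)) fun h => ?_
    exact succ_ne_emp _ (hF' _ _ hw.emp_mem (hw.succ_mem hw.emp_mem) h).symm
  have hsum : Dominated (sum x x) x :=
    (hx.dominated_or hfx (dominated_sum_left x x) ((hxp.sum hxp).trans hpp)).resolve_right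
      fun h => not_pow_dominated_prod hw hwx (h.trans hsum_prod)
  have hprod_pow : Dominated (prod (pow x) (pow x)) (pow x) :=
    (prod_pow_dominated x).trans hsum.pow
  have hprod : Dominated (prod x x) x :=
    (hx.dominated_or hfx ((dominated_sum_left x x).trans hsum_prod)
      ((hxp.prod hxp).trans hprod_pow)).resolve_right (not_pow_dominated_prod hw hwx)
  obtain ⟨h, hh, -, hhd⟩ := exists_hartogs x
  have hhpp : Dominated h (pow (pow x)) := hhd.trans hprod.pow.pow
  have hh_le : Dominated h (pow x) := by
    rcases hpow.dominated_or hfp (dominated_sum_left (pow x) h)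
      (((dominated_pow (pow x)).sum hhpp).trans (sum_pow_dominated hw hwp)) with hle | hle
    · exact (dominated_sum_right _ _).trans hle
    -- Cancelling 𝒫x gives 𝒫𝒫x ≼ h, so 𝒫x is equinumerous with an ordinal a. By Cantor a does not
    -- inject into x, hence h ⊆ a.
    · have hpph := pow_dominated_of_sum
        ((prod_pow_dominated (pow x)).trans hpp.pow) hle
      obtain ⟨a, ha, hae⟩ := isWellOrderable_of_dominated hh.1 ((dominated_pow (pow x)).trans hpph)
      have hax : ¬ Dominated a x := fun hax => not_pow_dominated x (hae.dominated.trans hax)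
      exact (Dominated.of_subset (hh.2.2 a ha hax)).trans hae.dominated_symm
  have hle_h : Dominated (pow x) h := by
    -- The lower alternative x + h ≼ x would inject the Hartogs number into x; the upper one leaves
    -- 𝒫x ≼ h after x is cancelled.
    rcases hx.dominated_or hfx (dominated_sum_left x h) ((hxp.sum hh_le).trans hpp) with hle | hle
    · exact (hh.2.1 ((dominated_sum_right _ _).trans hle)).elim
    · exact pow_dominated_of_sum hprod_pow hle
  exact ⟨⟨h, hh, .of_dominated hh_le hle_h⟩, ⟨h, hh.1, .of_dominated hle_h hh_le⟩,
    isWellOrderable_of_dominated hh.1 (hxp.trans hle_h)⟩
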